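/- All graphs are finite. A graph is \emph{outerplanar} if it has a plane embedding such that all its vertices lie on the boundary of one face, and an outerplanar graph is \emph{maximal outerplanar} if the addition of any edge between two non-adjacent vertices results in a graph that is not outerplanar. Let $\mathcal{OP}_n$ be the set of all maximal outerplanar graphs of order $n$. A multigraph is \emph{triangle decomposable} if its edge set can be partitioned such that the subgraph induced by each set in the partition is isomorphic to $K_3$. For a simple graph $G$, let $\varepsilon_\Delta(G)$ be the minimum number of multi-edges that must be added to $G$ between already adjacent vertices to form a triangle decomposable multigraph, and let $\varepsilon_\Delta(\mathcal{OP}_n) = \min\{\varepsilon_\Delta(G) : G \in \mathcal{OP}_n\}$. Theorem. For all $n \geq 3$, $n \equiv 2 \pmod 3$ if and only if $\varepsilon_\Delta(\mathcal{OP}_n) = 2$. -/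

import Mathlib

/-- The Euclidean plane. -/
abbrev Plane : Type := EuclideanSpace ℝ (Fin 2)

/-- `A` is a simple arc in the plane with end points `p` and `q`: the image of an injective
continuous path from `p` to `q`. -/
def IsSimpleArc (A : Set Plane) (p q : Plane) : Prop :=
  ∃ γ : Path p q, Function.Injective γ ∧ Set.range γ = A

/-- A plane embedding of a simple graph: vertices are distinct points of the plane, every edge is a
simple arc joining its two end points, no arc passes through a vertex other than its end points,
and two different arcs meet at most in vertices. -/
structure PlaneEmbedding {V : Type*} (G : SimpleGraph V) where
  /-- the point that represents a vertex -/
  pos : V → Plane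
  /-- the arc that represents an edge -/
  arc : G.edgeSet → Set Plane
  pos_injective : Function.Injective pos
  arc_isSimpleArc : ∀ (u v : V) (h : G.Adj u v), IsSimpleArc (arc ⟨s(u, v), h⟩) (pos u) (pos v)
  mem_of_pos_mem_arc : ∀ (v : V) (e : G.edgeSet), pos v ∈ arc e → v ∈ (e : Sym2 V)
  arc_inter_arc : ∀ e f : G.edgeSet, e ≠ f → arc e ∩ arc f ⊆ Set.range pos

namespace PlaneEmbedding

variable {V : Type*} {G : SimpleGraph V}

/-- The set of all points of the plane that lie on the drawing. -/
def carrier (D : PlaneEmbedding G) : Set Plane :=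
  Set.range D.pos ∪ ⋃ e : G.edgeSet, D.arc e

/-- A face is a connected component of the complement of the drawing. -/
def IsFace (D : PlaneEmbedding G) (F : Set Plane) : Prop :=
  ∃ x ∈ D.carrierᶜ, F = connectedComponentIn D.carrierᶜ x

end PlaneEmbedding

/-- A graph is outerplanar if it has a plane embedding in which all vertices lie on the boundary
of one face. -/
def IsOuterplanar {V : Type*} (G : SimpleGraph V) : Prop :=
  ∃ D : PlaneEmbedding G, ∃ F : Set Plane, D.IsFace F ∧ ∀ v : V, D.pos v ∈ frontier F

/-- An outerplanar graph is maximal outerplanar if joining any two distinct non-adjacent vertices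
by an edge results in a graph that is not outerplanar. -/
def IsMaximalOuterplanar {V : Type*} (G : SimpleGraph V) : Prop :=
  IsOuterplanar G ∧
    ∀ u v : V, u ≠ v → ¬ G.Adj u v → ¬ IsOuterplanar (G ⊔ SimpleGraph.edge u v)

/-- The maximal outerplanar graphs of order `n`, on the vertex set `Fin n`. -/
def maximalOuterplanarGraphs (n : ℕ) : Set (SimpleGraph (Fin n)) :=
  {G | IsMaximalOuterplanar G}

/-- The multiset `t` consists of the three edges of a triangle on the vertex set `V`. -/
def IsTriangleEdges {V : Type*} (t : Multiset (Sym2 V)) : Prop :=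
  ∃ a b c : V, a ≠ b ∧ b ≠ c ∧ a ≠ c ∧ t = {s(a, b), s(b, c), s(a, c)}

/-- A multigraph on `V`, given by its multiset `E` of edges, is triangle decomposable if `E` can be
partitioned into sub-multisets each of which is the edge set of a triangle. -/
def IsTriangleDecomposable {V : Type*} (E : Multiset (Sym2 V)) : Prop :=
  ∃ T : Multiset (Multiset (Sym2 V)), (∀ t ∈ T, IsTriangleEdges t) ∧ T.sum = E

/-- The edges of a finite simple graph as a multiset, every edge with multiplicity one. -/
noncomputable def edgeMultiset {V : Type*} [Finite V] (G : SimpleGraph V) : Multiset (Sym2 V) :=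
  G.edgeSet.toFinite.toFinset.val

/-- The least number of multi-edges that have to be added to `G` between already adjacent vertices
(with repetition allowed) to form a triangle decomposable multigraph; it is `⊤` if there is no
way to do so. -/
noncomputable def triangleEpsilon {V : Type*} [Finite V] (G : SimpleGraph V) : ℕ∞ :=
  sInf {k : ℕ∞ | ∃ M : Multiset (Sym2 V), (∀ e ∈ M, e ∈ G.edgeSet) ∧
    IsTriangleDecomposable (edgeMultiset G + M) ∧ k = (Multiset.card M : ℕ∞)}

/-- The minimum of `triangleEpsilon G` over all maximal outerplanar graphs `G` of order `n`. -/
noncomputable def triangleEpsilonOP (n : ℕ) : ℕ∞ :=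
  sInf (triangleEpsilon '' maximalOuterplanarGraphs n)

/-!
Every maximal outerplanar graph of order `n ≥ 2` has `2 n - 3` edges. Since the number of edges of a
triangle decomposable multigraph is divisible by three, `k` additional edges can only suffice if
`2 n - 3 + k` is divisible by three. For `k = 2` this says `n ≡ 2` modulo three, and for
`n ≡ 2` it excludes `k = 0` and `k = 1`. Conversely, for `n = 3 m + 2` two edges suffice for a
suitable triangulated polygon `stripGraph`: each step of its construction adds six edges, which
form two edge-disjoint triangles (`triangleEpsilon_stripGraph_le`).

The number of edges is found by identifying outerplanar graphs with the graphs whose vertices can be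
placed on a line such that the edges, drawn on one side, do not cross. For such a graph to which no
edge can be added the count is an induction on intervals (`pairCount_of_maximal`). A noncrossing graph
is outerplanar by drawing it with chords of a parabola (`SimpleGraph.NoncrossingAt.isOuterplanar`). The
reverse direction has a topological and a combinatorial part.

* Topology: if three closed sets join `p` to `q`, meet only there, and stay connected when these two
  points are removed, then no connected set in their complement touches all three of them away
  from `p` and `q`
  (`no_theta_curve`). This is where the plane enters, through the function `(z - p) / (z - q)`: it has
  a continuous logarithm off each of the three sets, but none on the plane punctured at `p` and `q`.
  Hence an outerplanar graph has no `K₂,₃` minor (`PlaneEmbedding.not_isTheta`), and no `K₄` either,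
  since the face would touch an edge of `K₄` in an inner point, which then serves as an additional
  vertex (`PlaneEmbedding.not_isNClique_four`).
* Combinatorics: a graph without `K₂,₃` minor and without `K₄` has a noncrossing arrangement
  (`SimpleGraph.exists_arrangement`). The induction is on vertex sets `S`, together with the stronger
  claim that two vertices `a`, `b` which are connected outside `S` can be made the ends of the
  arrangement: if they are also connected through `S`, then by the absence of `K₂,₃` there is a
  cut vertex, at which `S` is split (`SimpleGraph.EndPair.exists_cut`).
-/

/-! ### Continuous logarithms and theta curves in the complex plane -/

section

open Set Topology

/-- Off a set `P` that joins `q` to `p`, the quotient `(z - p) / (z - q)` has a continuous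
logarithm: move the zero `p` to `q` along `P`, and lift the resulting homotopy to the
constant `1` through the covering map `exp`. -/
theorem JoinedIn.exists_continuousOn_log {P : Set ℂ} {p q : ℂ} (h : JoinedIn P q p) :
    ∃ g : ℂ → ℂ, ContinuousOn g Pᶜ ∧ ∀ z ∈ Pᶜ, Complex.exp (g z) = (z - p) / (z - q) := by
  classical
  obtain ⟨γ, hγ⟩ := h
  have hne : ∀ (t : unitInterval) (z : (Pᶜ : Set ℂ)), (z : ℂ) - γ t ≠ 0 := by
    intro t z hz
    exact z.2 (by rw [sub_eq_zero.mp hz]; exact hγ t)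
  have hne0 : ∀ z : (Pᶜ : Set ℂ), (z : ℂ) - q ≠ 0 := by
    intro z; simpa using hne 0 z
  let H : C(unitInterval × (Pᶜ : Set ℂ), {w : ℂ // w ≠ 0}) :=
    ⟨fun x => ⟨((x.2 : ℂ) - γ x.1) / ((x.2 : ℂ) - q), div_ne_zero (hne _ _) (hne0 _)⟩, by
      refine Continuous.subtype_mk ?_ _
      refine Continuous.div ?_ ?_ (fun x => hne0 _)
      · fun_prop
      · fun_prop⟩
  have h0 : ∀ z, H (0, z) = (fun w : ℂ => (⟨_, w.exp_ne_zero⟩ : {w : ℂ // w ≠ 0}))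
      ((0 : C((Pᶜ : Set ℂ), ℂ)) z) := by
    intro z
    apply Subtype.ext
    simp [H, div_self (hne0 z)]
  let K := Complex.isCoveringMap_exp.liftHomotopy H 0 h0
  have hK := Complex.isCoveringMap_exp.liftHomotopy_lifts H 0 h0
  refine ⟨fun z => if hz : z ∈ Pᶜ then K (1, ⟨z, hz⟩) else 0, ?_, ?_⟩
  · rw [continuousOn_iff_continuous_domRestrict]
    have : (Pᶜ).domRestrict (fun z => if hz : z ∈ Pᶜ then K (1, ⟨z, hz⟩) else 0)
        = fun z => K (1, z) := by
      funext z
      exact dif_pos z.2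
    rw [this]
    fun_prop
  · intro z hz
    simp only [dif_pos hz]
    have : Complex.exp (K (1, ⟨z, hz⟩)) = (z - γ 1) / (z - q) :=
      congrArg Subtype.val (congrFun hK (1, ⟨z, hz⟩))
    rw [this, γ.target]

theorem Complex.eq_of_exp_eq_of_norm_sub_lt {a b : ℂ} (h : Complex.exp a = Complex.exp b)
    (hab : ‖a - b‖ < 2 * Real.pi) : a = b := by
  obtain ⟨n, hn⟩ := Complex.exp_eq_exp_iff_exists_int.mp h
  have hab' : ‖(n : ℂ) * (2 * Real.pi * Complex.I)‖ < 2 * Real.pi := by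
    rwa [hn, add_sub_cancel_left] at hab
  have hpi := Real.pi_pos
  have hnorm : ‖(n : ℂ) * (2 * Real.pi * Complex.I)‖ = |(n : ℝ)| * (2 * Real.pi) := by
    simp [abs_of_pos hpi]
  rw [hnorm] at hab'
  have h1 : |(n : ℝ)| < 1 := by
    by_contra hc
    nlinarith [not_lt.mp hc]
  have hn0 : n = 0 := by
    rw [← Int.cast_abs, ← Int.cast_one, Int.cast_lt] at h1
    exact Int.abs_lt_one_iff.mp h1
  simpa [hn0] using hn

/-- Two continuous logarithms of the same function agree on an open set. -/
theorem isOpen_setOf_log_eq {X : Type*} [TopologicalSpace X] {U : Set X} (hU : IsOpen U)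
    {f g : X → ℂ} (hf : ContinuousOn f U) (hg : ContinuousOn g U)
    (h : ∀ x ∈ U, Complex.exp (f x) = Complex.exp (g x)) : IsOpen {x ∈ U | f x = g x} := by
  have hc : ContinuousOn (fun x => ‖f x - g x‖) U := (hf.sub hg).norm
  convert! hc.isOpen_inter_preimage hU (isOpen_Iio (a := 2 * Real.pi)) using 1
  ext x
  constructor
  · rintro ⟨hx, he⟩
    exact ⟨hx, by simp [he, Real.pi_pos]⟩
  · rintro ⟨hx, he⟩
    exact ⟨hx, Complex.eq_of_exp_eq_of_norm_sub_lt (h x hx) he⟩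

theorem isOpen_setOf_ne_of_continuousOn {X : Type*} [TopologicalSpace X] {U : Set X}
    (hU : IsOpen U) {f g : X → ℂ} (hf : ContinuousOn f U) (hg : ContinuousOn g U) :
    IsOpen {x ∈ U | f x ≠ g x} := by
  convert! (hf.sub hg).isOpen_inter_preimage hU (isOpen_compl_singleton (x := 0)) using 1
  ext x
  simp [sub_eq_zero]

/-- Two continuous logarithms of the same function on a preconnected set that agree at one point
agree everywhere. -/
theorem eqOn_of_exp_eq {X : Type*} [TopologicalSpace X] {D : Set X} (hD : IsPreconnected D)
    {f g : X → ℂ} (hf : ContinuousOn f D) (hg : ContinuousOn g D)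
    (h : ∀ x ∈ D, Complex.exp (f x) = Complex.exp (g x)) {x₀ : X} (hx₀ : x₀ ∈ D)
    (he : f x₀ = g x₀) : EqOn f g D :=
  Complex.isCoveringMap_exp.eqOn_of_comp_eqOn hD hf hg
    (fun x hx => Subtype.ext (h x hx)) hx₀ he

/-- On the plane punctured at `p` and `q` the quotient `(z - p) / (z - q)` has no continuous
logarithm, since its argument changes by `2π` along a small circle round `p`. -/
theorem not_exists_continuousOn_log {p q : ℂ} (hpq : p ≠ q) :
    ¬ ∃ g : ℂ → ℂ, ContinuousOn g {p, q}ᶜ ∧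
      ∀ z ∈ ({p, q}ᶜ : Set ℂ), Complex.exp (g z) = (z - p) / (z - q) := by
  rintro ⟨g, hg, hexp⟩
  have hd : q - p ≠ 0 := sub_ne_zero.mpr hpq.symm
  -- the circle `z θ` has radius half the distance of `p` and `q`
  let u : ℝ → ℂ := fun θ => Complex.exp (θ * Complex.I) / 2
  let z : ℝ → ℂ := fun θ => p + (q - p) * u θ
  have hu : Continuous u := by fun_prop
  have hz : Continuous z := by fun_prop
  have hun : ∀ θ, ‖u θ‖ = 1 / 2 := by
    intro θ; simp [u, Complex.norm_exp_ofReal_mul_I]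
  have hu0 : ∀ θ, u θ ≠ 0 := by
    intro θ h; have := hun θ; rw [h] at this; norm_num at this
  have hu1 : ∀ θ, 1 - u θ ∈ Complex.slitPlane := by
    intro θ
    left
    have h1 := Complex.re_le_norm (u θ)
    rw [hun] at h1
    simp only [Complex.sub_re, Complex.one_re]; linarith
  have hmem : ∀ θ, z θ ∈ ({p, q}ᶜ : Set ℂ) := by
    intro θ h
    rcases h with h | h
    · have : (q - p) * u θ = 0 := by simpa [z] using h
      exact (mul_ne_zero hd (hu0 θ)) this
    · have h : (q - p) * (1 - u θ) = 0 := by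
        have : z θ = q := h
        simp only [z] at this; linear_combination -this
      exact (mul_ne_zero hd (Complex.slitPlane_ne_zero (hu1 θ))) h
  let h : ℝ → ℂ := fun θ => g (z θ) + Complex.log (1 - u θ) - θ * Complex.I
  have hh : Continuous h := by
    have h1 : Continuous fun θ => g (z θ) := hg.comp_continuous hz hmem
    have h2 : Continuous fun θ => Complex.log (1 - u θ) :=
      Continuous.clog (by fun_prop) hu1
    exact (h1.add h2).sub (by fun_prop)
  have hE : ∀ θ, Complex.exp (h θ) = -1 / 2 := by
    intro θ
    have hs := Complex.slitPlane_ne_zero (hu1 θ)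
    simp only [h, Complex.exp_sub, Complex.exp_add, hexp _ (hmem θ), Complex.exp_log hs]
    have e1 : z θ - p = (q - p) * u θ := by simp [z]
    have e2 : z θ - q = -((q - p) * (1 - u θ)) := by simp only [z]; ring
    have e3 : Complex.exp (θ * Complex.I) = 2 * u θ := by simp only [u]; ring
    rw [e1, e2, e3]
    have := hu0 θ
    field_simp
  have hconst : h (2 * Real.pi) = h 0 :=
    eqOn_of_exp_eq isPreconnected_univ hh.continuousOn continuousOn_const
      (fun θ _ => by rw [hE, hE]) (mem_univ 0) rfl (mem_univ _)
  have hper : z (2 * Real.pi) = z 0 := by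
    simp [z, u]
  have hfin : h (2 * Real.pi) - h 0 = -(2 * Real.pi * Complex.I) := by
    have hu2 : u (2 * Real.pi) = u 0 := by simp [u]
    simp only [h, hper, hu2]; push_cast; ring
  rw [hconst, sub_self] at hfin
  exact Complex.two_pi_I_ne_zero (neg_eq_zero.mp hfin.symm)

/-- **Theta curve lemma.** Let `P i`, `i = 0, 1, 2`, be closed sets that join `p` to `q`, such that
the sets `P i \ {p, q}` are connected and pairwise disjoint. Then no connected set `F` in
the complement of the `P i` touches all three sets `P i \ {p, q}`.

If `g i` is a continuous logarithm of `(z - p) / (z - q)` off `P i`, normalised to agree on `F`,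
then at every point two of the three values agree; the majority value is a continuous
logarithm on the plane punctured at `p` and `q`, which does not exist. -/
theorem no_theta_curve {p q : ℂ} (hpq : p ≠ q) (P : Fin 3 → Set ℂ) (hcl : ∀ i, IsClosed (P i))
    (hP : ∀ i, JoinedIn (P i) q p) (hconn : ∀ i, IsPreconnected (P i \ {p, q}))
    (hdisj : ∀ i j, i ≠ j → P i ∩ P j ⊆ {p, q}) {F : Set ℂ} (hF : IsPreconnected F)
    (hFP : ∀ i, Disjoint F (P i)) (hFcl : ∀ i, (closure F ∩ (P i \ {p, q})).Nonempty) : False := by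
  classical
  obtain ⟨f₀, hf₀⟩ : F.Nonempty := closure_nonempty_iff.mp ((hFcl 0).mono inter_subset_left)
  have hf₀P : ∀ i, f₀ ∈ (P i)ᶜ := fun i => disjoint_left.mp (hFP i) hf₀
  choose g' hg' hexp' using fun i => (hP i).exists_continuousOn_log
  let g : Fin 3 → ℂ → ℂ := fun i z => g' i z - g' i f₀ + g' 0 f₀
  have hg : ∀ i, ContinuousOn (g i) (P i)ᶜ := fun i =>
    ((hg' i).sub continuousOn_const).add continuousOn_const
  have hexp : ∀ i, ∀ z ∈ (P i)ᶜ, Complex.exp (g i z) = (z - p) / (z - q) := by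
    intro i z hz
    simp only [g, Complex.exp_add, Complex.exp_sub, hexp' i z hz, hexp' i f₀ (hf₀P i),
      hexp' 0 f₀ (hf₀P 0)]
    refine div_mul_cancel₀ _ ?_
    rw [← hexp' 0 f₀ (hf₀P 0)]
    exact Complex.exp_ne_zero _
  have hgf₀ : ∀ i j, g i f₀ = g j f₀ := by intro i j; simp [g]
  let E : Fin 3 → Fin 3 → Set ℂ := fun i j => {z ∈ (P i)ᶜ ∩ (P j)ᶜ | g i z = g j z}
  have hop : ∀ i j, IsOpen ((P i)ᶜ ∩ (P j)ᶜ) := fun i j =>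
    (hcl i).isOpen_compl.inter (hcl j).isOpen_compl
  have hEo : ∀ i j, IsOpen (E i j) := fun i j =>
    isOpen_setOf_log_eq (hop i j) ((hg i).mono inter_subset_left) ((hg j).mono inter_subset_right)
      (fun z hz => by rw [hexp i z hz.1, hexp j z hz.2])
  -- two logarithms agree on the interior of the third arc, which is connected to `F`
  have hE : ∀ i j k, k ≠ i → k ≠ j → P k \ {p, q} ⊆ E i j := by
    intro i j k hki hkj
    obtain ⟨x, hxF, hxP⟩ := hFcl k
    have hsub : F ∪ (P k \ {p, q}) ⊆ (P i)ᶜ ∩ (P j)ᶜ := by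
      rintro z (hz | hz)
      · exact ⟨disjoint_left.mp (hFP i) hz, disjoint_left.mp (hFP j) hz⟩
      · exact ⟨fun h => hz.2 (hdisj k i hki ⟨hz.1, h⟩), fun h => hz.2 (hdisj k j hkj ⟨hz.1, h⟩)⟩
    have hpre : IsPreconnected (F ∪ (P k \ {p, q})) := by
      have h1 : IsPreconnected (F ∪ {x}) :=
        hF.subset_closure subset_union_left
          (union_subset subset_closure (singleton_subset_iff.mpr hxF))
      have h2 := IsPreconnected.union x (by simp) hxP h1 (hconn k)
      rwa [union_assoc, singleton_union, insert_eq_of_mem hxP] at h2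
    have heq := eqOn_of_exp_eq hpre ((hg i).mono (hsub.trans inter_subset_left))
      ((hg j).mono (hsub.trans inter_subset_right))
      (fun z hz => by rw [hexp i z (hsub hz).1, hexp j z (hsub hz).2])
      (mem_union_left _ hf₀) (hgf₀ i j)
    exact fun z hz => ⟨hsub (mem_union_right _ hz), heq (mem_union_right _ hz)⟩
  have hpP : ∀ i, p ∈ P i := fun i => (hP i).target_mem
  have hqP : ∀ i, q ∈ P i := fun i => (hP i).source_mem
  have hEsub : ∀ i j, E i j ⊆ {p, q}ᶜ := by
    rintro i j z ⟨⟨hz, -⟩, -⟩ (rfl | h)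
    · exact hz (hpP i)
    · rw [mem_singleton_iff] at h; subst h; exact hz (hqP i)
  let N : Set ℂ := {z ∈ (P 0)ᶜ ∩ (P 1)ᶜ | g 0 z ≠ g 1 z} ∩
    ({z ∈ (P 0)ᶜ ∩ (P 2)ᶜ | g 0 z ≠ g 2 z} ∩ {z ∈ (P 1)ᶜ ∩ (P 2)ᶜ | g 1 z ≠ g 2 z})
  have hNo : IsOpen N := by
    have := fun i j => isOpen_setOf_ne_of_continuousOn (hop i j)
      ((hg i).mono inter_subset_left) ((hg j).mono inter_subset_right)
    exact (this 0 1).inter ((this 0 2).inter (this 1 2))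
  have hcover : ({p, q}ᶜ : Set ℂ) ⊆ (E 0 1 ∪ (E 0 2 ∪ E 1 2)) ∪ N := by
    intro z hz
    by_cases h0 : z ∈ P 0
    · exact Or.inl (Or.inr (Or.inr (hE 1 2 0 (by decide) (by decide) ⟨h0, hz⟩)))
    by_cases h1 : z ∈ P 1
    · exact Or.inl (Or.inr (Or.inl (hE 0 2 1 (by decide) (by decide) ⟨h1, hz⟩)))
    by_cases h2 : z ∈ P 2
    · exact Or.inl (Or.inl (hE 0 1 2 (by decide) (by decide) ⟨h2, hz⟩))
    by_cases e1 : g 0 z = g 1 z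
    · exact Or.inl (Or.inl ⟨⟨h0, h1⟩, e1⟩)
    by_cases e2 : g 0 z = g 2 z
    · exact Or.inl (Or.inr (Or.inl ⟨⟨h0, h2⟩, e2⟩))
    by_cases e3 : g 1 z = g 2 z
    · exact Or.inl (Or.inr (Or.inr ⟨⟨h1, h2⟩, e3⟩))
    exact Or.inr ⟨⟨⟨h0, h1⟩, e1⟩, ⟨⟨h0, h2⟩, e2⟩, ⟨⟨h1, h2⟩, e3⟩⟩
  have hpre : IsPreconnected ({p, q}ᶜ : Set ℂ) :=
    ((toFinite {p, q}).countable.isPathConnected_compl_of_one_lt_rank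
      (by simp)).isConnected.isPreconnected
  have hWN : Disjoint (E 0 1 ∪ (E 0 2 ∪ E 1 2)) N := by
    rw [disjoint_left]
    rintro z (h | h | h) ⟨n1, n2, n3⟩
    · exact n1.2 h.2
    · exact n2.2 h.2
    · exact n3.2 h.2
  have hf₀E : f₀ ∈ E 0 1 := ⟨⟨hf₀P 0, hf₀P 1⟩, hgf₀ 0 1⟩
  have hall : ({p, q}ᶜ : Set ℂ) ⊆ E 0 1 ∪ (E 0 2 ∪ E 1 2) :=
    hpre.subset_left_of_subset_union ((hEo 0 1).union ((hEo 0 2).union (hEo 1 2))) hNo hWN hcover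
      ⟨f₀, hEsub 0 1 hf₀E, Or.inl hf₀E⟩
  refine not_exists_continuousOn_log hpq
    ⟨fun z => if z ∈ E 0 1 then g 0 z else g 2 z, fun z hz => ?_, fun z hz => ?_⟩
  · apply ContinuousAt.continuousWithinAt
    rcases hall hz with h | h
    · refine ((hg 0).continuousAt ((hcl 0).isOpen_compl.mem_nhds h.1.1)).congr ?_
      filter_upwards [(hEo 0 1).mem_nhds h] with w hw
      rw [if_pos hw]
    · have h2 : z ∈ (P 2)ᶜ := h.elim (fun h => h.1.2) (fun h => h.1.2)
      refine ((hg 2).continuousAt ((hcl 2).isOpen_compl.mem_nhds h2)).congr ?_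
      filter_upwards [((hEo 0 2).union (hEo 1 2)).mem_nhds h] with w hw
      split_ifs with hw1
      · rcases hw with hw | hw
        · exact hw.2.symm
        · exact hw.2.symm.trans hw1.2.symm
      · rfl
  · by_cases h : z ∈ E 0 1
    · simp only [if_pos h]; exact hexp 0 z h.1.1
    · simp only [if_neg h]
      rcases hall hz with h' | h' | h'
      · exact absurd h' h
      · exact hexp 2 z h'.1.2
      · exact hexp 2 z h'.1.2

end

/-! ### Connected vertex sets and minors -/

namespace SimpleGraph

variable {V : Type*} (G : SimpleGraph V)

/-- Some edge of `G` joins the vertex sets `A` and `B`. -/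
def Touches (A B : Set V) : Prop := ∃ a ∈ A, ∃ b ∈ B, G.Adj a b

/-- The vertex set `X` induces a connected subgraph, expressed by cuts: it is nonempty, and each
set `A` that contains some but not all vertices of `X` is left by an edge within `X`. -/
def ConnOn (X : Set V) : Prop :=
  X.Nonempty ∧ ∀ A : Set V, ∀ a ∈ X, ∀ b ∈ X, a ∈ A → b ∉ A →
    ∃ u ∈ X, ∃ v ∈ X, u ∈ A ∧ v ∉ A ∧ G.Adj u v

/-- The connected component of `x` in the subgraph induced by `S`. -/
def compIn (S : Set V) (x : V) : Set V := {y | ∃ C ⊆ S, G.ConnOn C ∧ x ∈ C ∧ y ∈ C}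

variable {G}

theorem Touches.symm {A B : Set V} (h : G.Touches A B) : G.Touches B A := by
  obtain ⟨a, ha, b, hb, hab⟩ := h
  exact ⟨b, hb, a, ha, hab.symm⟩

theorem Touches.mono {A B A' B' : Set V} (h : G.Touches A B) (hA : A ⊆ A') (hB : B ⊆ B') :
    G.Touches A' B' := by
  obtain ⟨a, ha, b, hb, hab⟩ := h
  exact ⟨a, hA ha, b, hB hb, hab⟩

theorem touches_singleton {a b : V} : G.Touches {a} {b} ↔ G.Adj a b := by
  simp [Touches]

theorem touches_singleton_right {A : Set V} {b : V} : G.Touches A {b} ↔ ∃ a ∈ A, G.Adj a b := by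
  simp [Touches]

theorem touches_union_right {A B C : Set V} :
    G.Touches A (B ∪ C) ↔ G.Touches A B ∨ G.Touches A C := by
  constructor
  · rintro ⟨a, ha, b, hb | hb, hab⟩
    · exact Or.inl ⟨a, ha, b, hb, hab⟩
    · exact Or.inr ⟨a, ha, b, hb, hab⟩
  · rintro (h | h)
    · exact h.mono subset_rfl Set.subset_union_left
    · exact h.mono subset_rfl Set.subset_union_right

theorem touches_union_left {A B C : Set V} :
    G.Touches (B ∪ C) A ↔ G.Touches B A ∨ G.Touches C A := by
  constructor
  · intro h
    exact (touches_union_right.mp h.symm).imp Touches.symm Touches.symm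
  · rintro (h | h)
    · exact h.mono Set.subset_union_left subset_rfl
    · exact h.mono Set.subset_union_right subset_rfl

theorem connOn_singleton (x : V) : G.ConnOn {x} := by
  refine ⟨Set.singleton_nonempty x, ?_⟩
  rintro A a rfl b rfl h h'
  exact absurd h h'

theorem ConnOn.union_of_mem {X Y : Set V} (hX : G.ConnOn X) (hY : G.ConnOn Y) {w : V}
    (hwX : w ∈ X) (hwY : w ∈ Y) : G.ConnOn (X ∪ Y) := by
  refine ⟨⟨w, Or.inl hwX⟩, fun A a ha b hb haA hbA => ?_⟩
  have key : ∀ Z ⊆ X ∪ Y, G.ConnOn Z → ∀ a ∈ Z, ∀ b ∈ Z, a ∈ A → b ∉ A →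
      ∃ u ∈ X ∪ Y, ∃ v ∈ X ∪ Y, u ∈ A ∧ v ∉ A ∧ G.Adj u v := by
    intro Z hZs hZ a ha b hb haA hbA
    obtain ⟨u, hu, v, hv, h⟩ := hZ.2 A a ha b hb haA hbA
    exact ⟨u, hZs hu, v, hZs hv, h⟩
  have hl : X ⊆ X ∪ Y := Set.subset_union_left
  have hr : Y ⊆ X ∪ Y := Set.subset_union_right
  by_cases hw : w ∈ A
  · rcases hb with hb | hb
    · exact key X hl hX w hwX b hb hw hbA
    · exact key Y hr hY w hwY b hb hw hbA
  · rcases ha with ha | ha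
    · exact key X hl hX a ha w hwX haA hw
    · exact key Y hr hY a ha w hwY haA hw

theorem ConnOn.pair {x y : V} (h : G.Adj x y) : G.ConnOn {x, y} := by
  refine ⟨⟨x, by simp⟩, ?_⟩
  rintro A a (rfl | rfl) b (rfl | rfl) ha hb
  · exact absurd ha hb
  · exact ⟨a, by simp, b, by simp, ha, hb, h⟩
  · exact ⟨a, by simp, b, by simp, ha, hb, h.symm⟩
  · exact absurd ha hb

theorem ConnOn.union {X Y : Set V} (hX : G.ConnOn X) (hY : G.ConnOn Y) (h : G.Touches X Y) :
    G.ConnOn (X ∪ Y) := by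
  obtain ⟨x, hx, y, hy, hxy⟩ := h
  have h1 := hX.union_of_mem (ConnOn.pair hxy) hx (by simp)
  have h2 := h1.union_of_mem hY (w := y) (by simp) hy
  have : X ∪ {x, y} ∪ Y = X ∪ Y := by
    ext z; simp only [Set.mem_union, Set.mem_insert_iff, Set.mem_singleton_iff]
    constructor
    · rintro ((h | rfl | rfl) | h) <;> simp [*]
    · rintro (h | h) <;> simp [h]
  rwa [this] at h2

theorem compIn_subset {S : Set V} {x : V} : G.compIn S x ⊆ S := by
  rintro y ⟨C, hC, -, -, hy⟩
  exact hC hy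

theorem mem_compIn_self {S : Set V} {x : V} (hx : x ∈ S) : x ∈ G.compIn S x :=
  ⟨{x}, by simpa using hx, connOn_singleton x, rfl, rfl⟩

theorem connOn_compIn {S : Set V} {x : V} (hx : x ∈ S) : G.ConnOn (G.compIn S x) := by
  refine ⟨⟨x, mem_compIn_self hx⟩, fun A a ha b hb haA hbA => ?_⟩
  obtain ⟨C, hCS, hC, hxC, haC⟩ := ha
  obtain ⟨D, hDS, hD, hxD, hbD⟩ := hb
  obtain ⟨u, hu, v, hv, h⟩ := (hC.union_of_mem hD hxC hxD).2 A a (Or.inl haC) b (Or.inr hbD) haA hbA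
  have key : C ∪ D ⊆ G.compIn S x := fun w hw =>
    ⟨C ∪ D, Set.union_subset hCS hDS, hC.union_of_mem hD hxC hxD, Or.inl hxC, hw⟩
  exact ⟨u, key hu, v, key hv, h⟩

theorem ConnOn.subset_compIn {S C : Set V} {x y : V} (hC : G.ConnOn C) (hCS : C ⊆ S)
    (hy : y ∈ C) (hyx : y ∈ G.compIn S x) : C ⊆ G.compIn S x := by
  obtain ⟨D, hDS, hD, hxD, hyD⟩ := hyx
  exact fun w hw => ⟨D ∪ C, Set.union_subset hDS hCS, hD.union_of_mem hC hyD hy, Or.inl hxD,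
    Or.inr hw⟩

theorem mem_compIn_of_adj {S : Set V} {x u v : V} (hu : u ∈ G.compIn S x) (hv : v ∈ S)
    (h : G.Adj u v) : v ∈ G.compIn S x :=
  (ConnOn.pair h).subset_compIn (S := S)
    (by rintro w (rfl | rfl); exacts [compIn_subset hu, hv]) (by simp) hu (by simp)

/-- A component of `C` minus a vertex set `B` touches `B`, if `C` is connected and meets `B`. -/
theorem ConnOn.touches_compIn {C B : Set V} {x : V} (hC : G.ConnOn C) (hx : x ∈ C) (hxB : x ∉ B)
    (hB : (C ∩ B).Nonempty) : G.Touches (G.compIn (C \ B) x) B := by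
  obtain ⟨b, hbC, hbB⟩ := hB
  obtain ⟨u, hu, v, hv, huA, hvA, huv⟩ := hC.2 (G.compIn (C \ B) x) x hx b hbC
    (mem_compIn_self ⟨hx, hxB⟩) (fun h => (compIn_subset h).2 hbB)
  refine ⟨u, huA, v, ?_, huv⟩
  by_contra hvB
  exact hvA (mem_compIn_of_adj huA ⟨hv, hvB⟩ huv)

/-- A finite connected vertex set with at least two elements has a vertex whose removal leaves it
connected. -/
theorem ConnOn.exists_diff_singleton [Finite V] {X : Set V} (hX : G.ConnOn X)
    (hn : X.Nontrivial) : ∃ v ∈ X, G.ConnOn (X \ {v}) ∧ G.Touches {v} (X \ {v}) := by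
  have hfin : {A : Set V | A ⊂ X ∧ G.ConnOn A}.Finite := Set.toFinite _
  obtain ⟨x, hx⟩ := hX.1
  have hne : {A : Set V | A ⊂ X ∧ G.ConnOn A}.Nonempty :=
    ⟨{x}, by
      refine ⟨⟨by simpa using hx, fun h => ?_⟩, connOn_singleton x⟩
      exact (Set.not_nontrivial_singleton (hn.mono h))⟩
  obtain ⟨A, ⟨⟨hAX, hXA⟩, hA⟩, hmax⟩ := hfin.exists_maximal hne
  obtain ⟨a, ha⟩ := hA.1
  obtain ⟨b, hb, hbA⟩ := Set.not_subset.mp hXA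
  obtain ⟨u, hu, v, hv, huA, hvA, huv⟩ := hX.2 A a (hAX ha) b hb ha hbA
  have hB : G.ConnOn (A ∪ {v}) := hA.union (connOn_singleton v) ⟨u, huA, v, rfl, huv⟩
  have hBX : X ⊆ A ∪ {v} := by
    by_contra hc
    have h1 : A ∪ {v} ⊂ X := ⟨Set.union_subset hAX (by simpa using hv), hc⟩
    exact hvA (hmax (y := A ∪ {v}) ⟨h1, hB⟩ Set.subset_union_left (Or.inr rfl))
  have hE : X \ {v} = A := by
    ext w
    constructor
    · rintro ⟨hw, hwv⟩
      exact (hBX hw).resolve_right hwv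
    · intro hw
      exact ⟨hAX hw, fun h => hvA (h ▸ hw)⟩
  exact ⟨v, hv, hE ▸ hA, v, rfl, u, hE ▸ huA, huv.symm⟩

variable (G) in
/-- A model of `K₂,₃` as a minor: `A` and `B` stand for the vertices of degree three, and `X`, `Y`,
`Z` for those of degree two. -/
structure IsTheta (A B X Y Z : Set V) : Prop where
  cA : G.ConnOn A
  cB : G.ConnOn B
  cX : G.ConnOn X
  cY : G.ConnOn Y
  cZ : G.ConnOn Z
  dAB : Disjoint A B
  dAX : Disjoint A X
  dAY : Disjoint A Y
  dAZ : Disjoint A Z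
  dBX : Disjoint B X
  dBY : Disjoint B Y
  dBZ : Disjoint B Z
  dXY : Disjoint X Y
  dXZ : Disjoint X Z
  dYZ : Disjoint Y Z
  tAX : G.Touches A X
  tAY : G.Touches A Y
  tAZ : G.Touches A Z
  tBX : G.Touches B X
  tBY : G.Touches B Y
  tBZ : G.Touches B Z

variable (G) in
/-- A model of `K₄` as a minor. -/
structure IsK4Minor (A B C D : Set V) : Prop where
  cA : G.ConnOn A
  cB : G.ConnOn B
  cC : G.ConnOn C
  cD : G.ConnOn D
  dAB : Disjoint A B
  dAC : Disjoint A C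
  dAD : Disjoint A D
  dBC : Disjoint B C
  dBD : Disjoint B D
  dCD : Disjoint C D
  tAB : G.Touches A B
  tAC : G.Touches A C
  tAD : G.Touches A D
  tBC : G.Touches B C
  tBD : G.Touches B D
  tCD : G.Touches C D

namespace IsTheta

variable {A B X Y Z : Set V}

theorem swap (h : G.IsTheta A B X Y Z) : G.IsTheta B A X Y Z :=
  ⟨h.cB, h.cA, h.cX, h.cY, h.cZ, h.dAB.symm, h.dBX, h.dBY, h.dBZ, h.dAX, h.dAY, h.dAZ,
    h.dXY, h.dXZ, h.dYZ, h.tBX, h.tBY, h.tBZ, h.tAX, h.tAY, h.tAZ⟩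

theorem swapXY (h : G.IsTheta A B X Y Z) : G.IsTheta A B Y X Z :=
  ⟨h.cA, h.cB, h.cY, h.cX, h.cZ, h.dAB, h.dAY, h.dAX, h.dAZ, h.dBY, h.dBX, h.dBZ,
    h.dXY.symm, h.dYZ, h.dXZ, h.tAY, h.tAX, h.tAZ, h.tBY, h.tBX, h.tBZ⟩

theorem swapYZ (h : G.IsTheta A B X Y Z) : G.IsTheta A B X Z Y :=
  ⟨h.cA, h.cB, h.cX, h.cZ, h.cY, h.dAB, h.dAX, h.dAZ, h.dAY, h.dBX, h.dBZ, h.dBY,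
    h.dXZ, h.dXY, h.dYZ.symm, h.tAX, h.tAZ, h.tAY, h.tBX, h.tBZ, h.tBY⟩

/-- In a `K₂,₃` minor, a vertex `v` of `A` may be moved to `X` if the rest `A'` of `A` is still
connected and touches `Y` and `Z`, and either touches `X` or leaves this to `v`. -/
theorem move (h : G.IsTheta A B X Y Z) {v : V} {A' : Set V} (hA : A = A' ∪ {v}) (hv : v ∉ A')
    (hA' : G.ConnOn A') (ht : G.Touches A' {v}) (hY : G.Touches A' Y) (hZ : G.Touches A' Z) :
    ∃ X', G.IsTheta A' B X' Y Z := by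
  subst hA
  have s : A' ⊆ A' ∪ {v} := Set.subset_union_left
  have r : {v} ⊆ A' ∪ {v} := Set.subset_union_right
  by_cases hX : G.Touches A' X
  · exact ⟨X, hA', h.cB, h.cX, h.cY, h.cZ, h.dAB.mono_left s, h.dAX.mono_left s,
      h.dAY.mono_left s, h.dAZ.mono_left s, h.dBX, h.dBY, h.dBZ, h.dXY, h.dXZ, h.dYZ, hX, hY, hZ,
      h.tBX, h.tBY, h.tBZ⟩
  · have hvX : G.Touches {v} X := (touches_union_left.mp h.tAX).resolve_left hX
    have hd : Disjoint A' {v} := by simpa using hv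
    exact ⟨X ∪ {v}, hA', h.cB, h.cX.union (connOn_singleton v) hvX.symm, h.cY, h.cZ,
      h.dAB.mono_left s, (h.dAX.mono_left s).union_right hd,
      h.dAY.mono_left s, h.dAZ.mono_left s, h.dBX.union_right (h.dAB.symm.mono_right r),
      h.dBY, h.dBZ, h.dXY.union_left (h.dAY.mono_left r), h.dXZ.union_left (h.dAZ.mono_left r),
      h.dYZ, ht.mono subset_rfl Set.subset_union_right, hY, hZ,
      h.tBX.mono subset_rfl Set.subset_union_left, h.tBY, h.tBZ⟩

/-- If the vertex `v` of `A` touches `X` and `Y`, then `A` may be replaced by `{v}`. -/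
theorem collapse (h : G.IsTheta A B X Y Z) {v : V} {A' : Set V} (hA : A = A' ∪ {v}) (hv : v ∉ A')
    (hA' : G.ConnOn A') (ht : G.Touches A' {v}) (hX : G.Touches {v} X) (hY : G.Touches {v} Y) :
    ∃ Z', G.IsTheta {v} B X Y Z' := by
  subst hA
  have s : A' ⊆ A' ∪ {v} := Set.subset_union_left
  have r : {v} ⊆ A' ∪ {v} := Set.subset_union_right
  by_cases hZ : G.Touches {v} Z
  · exact ⟨Z, connOn_singleton v, h.cB, h.cX, h.cY, h.cZ, h.dAB.mono_left r, h.dAX.mono_left r,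
      h.dAY.mono_left r, h.dAZ.mono_left r, h.dBX, h.dBY, h.dBZ, h.dXY, h.dXZ, h.dYZ, hX, hY, hZ,
      h.tBX, h.tBY, h.tBZ⟩
  · have hvZ : G.Touches A' Z := (touches_union_left.mp h.tAZ).resolve_right hZ
    have hd : Disjoint {v} A' := by simpa using hv
    exact ⟨Z ∪ A', connOn_singleton v, h.cB, h.cX, h.cY, h.cZ.union hA' hvZ.symm,
      h.dAB.mono_left r, h.dAX.mono_left r, h.dAY.mono_left r,
      (h.dAZ.mono_left r).union_right hd, h.dBX, h.dBY, h.dBZ.union_right (h.dAB.symm.mono_right s),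
      h.dXY, h.dXZ.union_right (h.dAX.symm.mono_right s),
      h.dYZ.union_right (h.dAY.symm.mono_right s),
      hX, hY, ht.symm.mono subset_rfl Set.subset_union_right,
      h.tBX, h.tBY, h.tBZ.mono subset_rfl Set.subset_union_left⟩

theorem exists_singleton_left [Finite V] (h : G.IsTheta A B X Y Z) :
    ∃ a X' Y' Z', G.IsTheta {a} B X' Y' Z' := by
  induction hn : A.ncard using Nat.strong_induction_on generalizing A X Y Z with
  | _ n ih =>
    rcases A.subsingleton_or_nontrivial with hs | hnt
    · obtain ⟨a, ha⟩ := h.cA.1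
      obtain rfl := hs.eq_singleton_of_mem ha
      exact ⟨a, X, Y, Z, h⟩
    obtain ⟨v, hv, hc, ht⟩ := h.cA.exists_diff_singleton hnt
    have hA : A = A \ {v} ∪ {v} := by
      rw [Set.sdiff_union_self, Set.union_eq_left.mpr (by simpa using hv)]
    have hvn : v ∉ A \ {v} := by simp
    have hlt : (A \ {v}).ncard < n := hn ▸ Set.ncard_sdiff_singleton_lt_of_mem hv
    have res : ∀ W : Set V, G.Touches A W → ¬ G.Touches (A \ {v}) W → G.Touches {v} W := by
      intro W h1 h2
      rw [hA] at h1
      exact (touches_union_left.mp h1).resolve_left h2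
    by_cases hX : G.Touches (A \ {v}) X <;> by_cases hY : G.Touches (A \ {v}) Y <;>
      by_cases hZ : G.Touches (A \ {v}) Z
    · obtain ⟨X', h'⟩ := h.move hA hvn hc ht.symm hY hZ; exact ih _ hlt h' rfl
    · obtain ⟨X', h'⟩ := h.swapYZ.swapXY.move hA hvn hc ht.symm hX hY; exact ih _ hlt h' rfl
    · obtain ⟨X', h'⟩ := h.swapXY.move hA hvn hc ht.symm hX hZ; exact ih _ hlt h' rfl
    · obtain ⟨Z', h'⟩ := h.swapXY.swapYZ.collapse hA hvn hc ht.symm (res _ h.tAY hY) (res _ h.tAZ hZ)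
      exact ⟨_, _, _, _, h'⟩
    · obtain ⟨X', h'⟩ := h.move hA hvn hc ht.symm hY hZ; exact ih _ hlt h' rfl
    · obtain ⟨Z', h'⟩ := h.swapYZ.collapse hA hvn hc ht.symm (res _ h.tAX hX) (res _ h.tAZ hZ)
      exact ⟨_, _, _, _, h'⟩
    · obtain ⟨Z', h'⟩ := h.collapse hA hvn hc ht.symm (res _ h.tAX hX) (res _ h.tAY hY)
      exact ⟨_, _, _, _, h'⟩
    · obtain ⟨Z', h'⟩ := h.collapse hA hvn hc ht.symm (res _ h.tAX hX) (res _ h.tAY hY)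
      exact ⟨_, _, _, _, h'⟩

/-- A `K₂,₃` minor contains one whose vertices of degree three are single vertices. -/
theorem exists_singletons [Finite V] (h : G.IsTheta A B X Y Z) :
    ∃ a b X' Y' Z', G.IsTheta {a} {b} X' Y' Z' := by
  obtain ⟨a, X', Y', Z', h1⟩ := h.exists_singleton_left
  obtain ⟨b, X', Y', Z', h2⟩ := h1.swap.exists_singleton_left
  exact ⟨a, b, X', Y', Z', h2.swap⟩

end IsTheta

namespace IsK4Minor

variable {A B C D : Set V}

theorem rotate (h : G.IsK4Minor A B C D) : G.IsK4Minor B C D A :=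
  ⟨h.cB, h.cC, h.cD, h.cA, h.dBC, h.dBD, h.dAB.symm, h.dCD, h.dAC.symm, h.dAD.symm, h.tBC, h.tBD,
    h.tAB.symm, h.tCD, h.tAC.symm, h.tAD.symm⟩

theorem cycle (h : G.IsK4Minor A B C D) : G.IsK4Minor A C D B :=
  ⟨h.cA, h.cC, h.cD, h.cB, h.dAC, h.dAD, h.dAB, h.dCD, h.dBC.symm, h.dBD.symm, h.tAC, h.tAD, h.tAB,
    h.tCD, h.tBC.symm, h.tBD.symm⟩

theorem swapBC (h : G.IsK4Minor A B C D) : G.IsK4Minor A C B D :=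
  ⟨h.cA, h.cC, h.cB, h.cD, h.dAC, h.dAB, h.dAD, h.dBC.symm, h.dCD, h.dBD, h.tAC, h.tAB, h.tAD,
    h.tBC.symm, h.tCD, h.tBD⟩

theorem mono_left (h : G.IsK4Minor A B C D) {A' : Set V} (hs : A' ⊆ A) (hc : G.ConnOn A')
    (hB : G.Touches A' B) (hC : G.Touches A' C) (hD : G.Touches A' D) : G.IsK4Minor A' B C D :=
  ⟨hc, h.cB, h.cC, h.cD, h.dAB.mono_left hs, h.dAC.mono_left hs, h.dAD.mono_left hs, h.dBC, h.dBD,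
    h.dCD, hB, hC, hD, h.tBC, h.tBD, h.tCD⟩

/-- If the part `A` of a `K₄` minor splits into connected parts `A₁`, `A₂`, where `A₁` touches `B`
and `A₂` touches `C` and `D`, then `A₂` and `B` are the vertices of degree three of a `K₂,₃`
minor. -/
theorem isTheta (h : G.IsK4Minor A B C D) {A₁ A₂ : Set V} (h₁ : A₁ ⊆ A) (h₂ : A₂ ⊆ A)
    (hd : Disjoint A₁ A₂) (c₁ : G.ConnOn A₁) (c₂ : G.ConnOn A₂) (ht : G.Touches A₁ A₂)
    (hB : G.Touches A₁ B) (hC : G.Touches A₂ C) (hD : G.Touches A₂ D) :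
    G.IsTheta A₂ B A₁ C D :=
  ⟨c₂, h.cB, c₁, h.cC, h.cD, h.dAB.mono_left h₂, hd.symm, h.dAC.mono_left h₂, h.dAD.mono_left h₂,
    h.dAB.symm.mono_right h₁, h.dBC, h.dBD, h.dAC.mono_left h₁, h.dAD.mono_left h₁, h.dCD,
    ht.symm, hC, hD, hB.symm, h.tBC, h.tBD⟩

theorem exists_singleton_left [Finite V] (hθ : ∀ A B X Y Z, ¬ G.IsTheta A B X Y Z)
    (h : G.IsK4Minor A B C D) : ∃ a ∈ A, G.IsK4Minor {a} B C D := by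
  induction hn : A.ncard using Nat.strong_induction_on generalizing A with
  | _ n ih =>
    rcases A.subsingleton_or_nontrivial with hs | hnt
    · obtain ⟨a, ha⟩ := h.cA.1
      obtain rfl := hs.eq_singleton_of_mem ha
      exact ⟨a, rfl, h⟩
    obtain ⟨v, hv, hc, ht⟩ := h.cA.exists_diff_singleton hnt
    have hA : A = A \ {v} ∪ {v} := by
      rw [Set.sdiff_union_self, Set.union_eq_left.mpr (by simpa using hv)]
    have hlt : (A \ {v}).ncard < n := hn ▸ Set.ncard_sdiff_singleton_lt_of_mem hv
    have s : A \ {v} ⊆ A := Set.sdiff_subset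
    have r : {v} ⊆ A := by simpa using hv
    have hd : Disjoint {v} (A \ {v}) := Set.disjoint_sdiff_right
    have cv := connOn_singleton (G := G) v
    have res : ∀ W : Set V, G.Touches A W → ¬ G.Touches (A \ {v}) W → G.Touches {v} W := by
      intro W h1 h2
      rw [hA] at h1
      exact (touches_union_left.mp h1).resolve_left h2
    -- the part of `A` that touches two of `B`, `C`, `D` becomes a vertex of degree three
    by_cases hB : G.Touches (A \ {v}) B <;> by_cases hC : G.Touches (A \ {v}) C <;>
      by_cases hD : G.Touches (A \ {v}) D
    · obtain ⟨a, ha, h'⟩ := ih _ hlt (h.mono_left s hc hB hC hD) rfl; exact ⟨a, s ha, h'⟩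
    · exact (hθ _ _ _ _ _ (h.cycle.cycle.isTheta
        (A₁ := {v}) (A₂ := A \ {v}) r s hd cv hc ht (res _ h.tAD hD) hB hC)).elim
    · exact (hθ _ _ _ _ _ (h.swapBC.isTheta
        (A₁ := {v}) (A₂ := A \ {v}) r s hd cv hc ht (res _ h.tAC hC) hB hD)).elim
    · exact (hθ _ _ _ _ _ (h.isTheta (A₁ := A \ {v}) (A₂ := {v}) s r hd.symm hc cv ht.symm hB
        (res _ h.tAC hC) (res _ h.tAD hD))).elim
    · exact (hθ _ _ _ _ _ (h.isTheta
        (A₁ := {v}) (A₂ := A \ {v}) r s hd cv hc ht (res _ h.tAB hB) hC hD)).elim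
    · exact (hθ _ _ _ _ _ (h.swapBC.isTheta (A₁ := A \ {v}) (A₂ := {v}) s r hd.symm hc cv ht.symm hC
        (res _ h.tAB hB) (res _ h.tAD hD))).elim
    · exact (hθ _ _ _ _ _ (h.cycle.cycle.isTheta (A₁ := A \ {v}) (A₂ := {v}) s r hd.symm hc cv
        ht.symm hD (res _ h.tAB hB) (res _ h.tAC hC))).elim
    · exact ⟨v, hv, h.mono_left r cv (res _ h.tAB hB) (res _ h.tAC hC) (res _ h.tAD hD)⟩

end IsK4Minor

end SimpleGraph

/-! ### Noncrossing arrangements on a line -/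

namespace SimpleGraph

variable {V : Type*} (G : SimpleGraph V)

/-- No two edges of `G` cross when the vertices are placed on a line (equivalently, on a circle) in
the order of the list `l` and the edges are drawn on one side of it. -/
def Noncrossing (l : List V) : Prop :=
  ∀ w x y z, [w, x, y, z].Sublist l → G.Adj w y → ¬ G.Adj x z

/-- `l` lists the vertices of `S`, each once, in an order without crossing edges. -/
structure IsArrangement (S : Set V) (l : List V) : Prop where
  nodup : l.Nodup
  mem_iff : ∀ x, x ∈ l ↔ x ∈ S
  nc : G.Noncrossing l

variable {G}

theorem _root_.List.four_sublist_append {w x y z : V} {l₁ l₂ : List V}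
    (h : [w, x, y, z].Sublist (l₁ ++ l₂)) :
    [w, x, y, z].Sublist l₂ ∨ ([w].Sublist l₁ ∧ [x, y, z].Sublist l₂) ∨
      ([w, x].Sublist l₁ ∧ [y, z].Sublist l₂) ∨ ([w, x, y].Sublist l₁ ∧ [z].Sublist l₂) ∨
      [w, x, y, z].Sublist l₁ := by
  obtain ⟨k₁, k₂, hk, h₁, h₂⟩ := List.sublist_append_iff.mp h
  rcases k₁ with _ | ⟨a, _ | ⟨b, _ | ⟨c, _ | ⟨d, _ | ⟨e, k₁⟩⟩⟩⟩⟩ <;>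
    simp only [List.nil_append, List.cons_append, List.cons.injEq, List.nil_eq,
      reduceCtorEq, and_false] at hk
  · subst hk; exact Or.inl h₂
  · obtain ⟨rfl, rfl⟩ := hk; exact Or.inr (Or.inl ⟨h₁, h₂⟩)
  · obtain ⟨rfl, rfl, rfl⟩ := hk; exact Or.inr (Or.inr (Or.inl ⟨h₁, h₂⟩))
  · obtain ⟨rfl, rfl, rfl, rfl⟩ := hk; exact Or.inr (Or.inr (Or.inr (Or.inl ⟨h₁, h₂⟩)))
  · obtain ⟨rfl, rfl, rfl, rfl, rfl⟩ := hk; exact Or.inr (Or.inr (Or.inr (Or.inr h₁)))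

theorem _root_.List.Nodup.not_pair_sublist_concat {l : List V} {b z : V} (h : (l ++ [b]).Nodup) :
    ¬ [b, z].Sublist (l ++ [b]) := by
  intro hs
  have hb : b ∉ l := fun hb => List.disjoint_of_nodup_append h hb (by simp)
  obtain ⟨k₁, k₂, hk, h₁, h₂⟩ := List.sublist_append_iff.mp hs
  rcases k₁ with _ | ⟨a, k₁⟩
  · have : k₂ = [b, z] := by simpa using hk.symm
    subst this
    simpa using h₂.length_le
  · simp only [List.cons_append, List.cons.injEq] at hk
    exact hb (h₁.subset (by simp [hk.1]))

theorem _root_.List.Nodup.not_pair_sublist_cons {l : List V} {a w : V} (h : (a :: l).Nodup) :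
    ¬ [w, a].Sublist (a :: l) := by
  intro hs
  have ha : a ∉ l := (List.nodup_cons.mp h).1
  cases hs with
  | cons _ h' => exact ha (h'.subset (by simp))
  | cons_cons _ h' => exact ha (h'.subset (by simp))

theorem Noncrossing.rotate {l₁ l₂ : List V} (h : G.Noncrossing (l₁ ++ l₂)) :
    G.Noncrossing (l₂ ++ l₁) := by
  intro w x y z hs h1 h2
  rcases List.four_sublist_append hs with s | ⟨s, s'⟩ | ⟨s, s'⟩ | ⟨s, s'⟩ | s
  · exact h w x y z (s.trans (List.sublist_append_left ..)) h1 h2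
  · exact h x y z w (s'.append s) h2 h1.symm
  · exact h y z w x (s'.append s) h1.symm h2.symm
  · exact h z w x y (s'.append s) h2.symm h1
  · exact h w x y z (s.trans (List.sublist_append_right ..)) h1 h2

namespace IsArrangement

variable {S A B : Set V}

theorem rotate {l₁ l₂ : List V} (h : G.IsArrangement S (l₁ ++ l₂)) :
    G.IsArrangement S (l₂ ++ l₁) :=
  ⟨(List.perm_append_comm.nodup_iff).mp h.nodup,
    fun x => by rw [← h.mem_iff, List.mem_append, List.mem_append, or_comm], h.nc.rotate⟩

theorem exists_cons {l : List V} (h : G.IsArrangement S l) {a : V} (ha : a ∈ S) :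
    ∃ l', G.IsArrangement S (a :: l') := by
  obtain ⟨s, t, rfl⟩ := List.append_of_mem ((h.mem_iff a).mpr ha)
  exact ⟨t ++ s, h.rotate⟩

theorem exists_concat {l : List V} (h : G.IsArrangement S l) {b : V} (hb : b ∈ S) :
    ∃ l', G.IsArrangement S (l' ++ [b]) := by
  obtain ⟨l', h'⟩ := h.exists_cons hb
  exact ⟨l', IsArrangement.rotate (l₁ := [b]) h'⟩

/-- Two arrangements may be put side by side if the only edge between them joins the first vertex
to the last one. -/
theorem append {a b : V} {l₁ l₂ : List V} (hA : G.IsArrangement A (a :: l₁))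
    (hB : G.IsArrangement B (l₂ ++ [b])) (hd : Disjoint A B)
    (he : ∀ u ∈ A, ∀ v ∈ B, G.Adj u v → u = a ∧ v = b) :
    G.IsArrangement (A ∪ B) (a :: ((l₁ ++ l₂) ++ [b])) := by
  have hl : a :: ((l₁ ++ l₂) ++ [b]) = (a :: l₁) ++ (l₂ ++ [b]) := by simp
  rw [hl]
  refine ⟨hA.nodup.append hB.nodup fun x h1 h2 =>
    Set.disjoint_left.mp hd ((hA.mem_iff x).mp h1) ((hB.mem_iff x).mp h2),
    fun x => by rw [List.mem_append, hA.mem_iff, hB.mem_iff, Set.mem_union], ?_⟩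
  have mA : ∀ {k : List V} {x}, k.Sublist (a :: l₁) → x ∈ k → x ∈ A :=
    fun hk hx => (hA.mem_iff _).mp (hk.subset hx)
  have mB : ∀ {k : List V} {x}, k.Sublist (l₂ ++ [b]) → x ∈ k → x ∈ B :=
    fun hk hx => (hB.mem_iff _).mp (hk.subset hx)
  intro w x y z hs h1 h2
  rcases List.four_sublist_append hs with s | ⟨s, s'⟩ | ⟨s, s'⟩ | ⟨s, s'⟩ | s
  · exact hB.nc _ _ _ _ s h1 h2
  · obtain ⟨-, rfl⟩ := he w (mA s (by simp)) y (mB s' (by simp)) h1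
    exact hB.nodup.not_pair_sublist_concat ((List.sublist_cons_self x [y, z]).trans s')
  · obtain ⟨-, rfl⟩ := he w (mA s (by simp)) y (mB s' (by simp)) h1
    exact hB.nodup.not_pair_sublist_concat s'
  · obtain ⟨rfl, -⟩ := he x (mA s (by simp)) z (mB s' (by simp)) h2
    exact hA.nodup.not_pair_sublist_cons ((List.sublist_append_left [w, x] [y]).trans s)
  · exact hA.nc _ _ _ _ s h1 h2

/-- Two arrangements that share the vertex `c`, the last of one and the first of the other, may
be joined at `c` if the only other edge between them joins the first vertex to the last one. -/
theorem join_vertex {a b c : V} {l₁ l₂ : List V} (hA : G.IsArrangement (A ∪ {c}) (a :: (l₁ ++ [c])))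
    (hB : G.IsArrangement (B ∪ {c}) (c :: (l₂ ++ [b]))) (hd : Disjoint A B) (hcB : c ∉ B)
    (he : ∀ u ∈ A, ∀ v ∈ B, G.Adj u v → u = a ∧ v = b) :
    G.IsArrangement (A ∪ B ∪ {c}) (a :: ((l₁ ++ c :: l₂) ++ [b])) := by
  have hl : a :: ((l₁ ++ c :: l₂) ++ [b]) = (a :: (l₁ ++ [c])) ++ (l₂ ++ [b]) := by simp
  rw [hl]
  have hBn : (l₂ ++ [b]).Nodup := (List.nodup_cons.mp hB.nodup).2
  have hcn : c ∉ l₂ ++ [b] := (List.nodup_cons.mp hB.nodup).1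
  have hB' : ∀ x, x ∈ l₂ ++ [b] ↔ x ∈ B := by
    intro x
    constructor
    · intro hx
      exact ((hB.mem_iff x).mp (List.mem_cons_of_mem c hx)).resolve_right
        (fun h => hcn (h ▸ hx))
    · intro hx
      exact (List.mem_cons.mp ((hB.mem_iff x).mpr (Or.inl hx))).resolve_left
        (fun h => hcB (h ▸ hx))
  refine ⟨hA.nodup.append hBn fun x h1 h2 => ?_, fun x => ?_, ?_⟩
  · rcases (hA.mem_iff x).mp h1 with h | h
    · exact Set.disjoint_left.mp hd h ((hB' x).mp h2)
    · exact hcn (h ▸ h2)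
  · rw [List.mem_append, hA.mem_iff, hB']
    simp only [Set.mem_union]; tauto
  have mA : ∀ {k : List V} {x}, k.Sublist (a :: (l₁ ++ [c])) → x ∈ k → x ≠ c → x ∈ A :=
    fun hk hx hc => ((hA.mem_iff _).mp (hk.subset hx)).resolve_right hc
  have mB : ∀ {k : List V} {x}, k.Sublist (l₂ ++ [b]) → x ∈ k → x ∈ B :=
    fun hk hx => (hB' _).mp (hk.subset hx)
  have hAn : ((a :: l₁) ++ [c]).Nodup := hA.nodup
  intro w x y z hs h1 h2
  rcases List.four_sublist_append hs with s | ⟨s, s'⟩ | ⟨s, s'⟩ | ⟨s, s'⟩ | s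
  · exact hB.nc _ _ _ _ (s.trans (List.sublist_cons_self ..)) h1 h2
  · by_cases hw : w = c
    · subst hw
      exact hB.nc _ _ _ _ (s'.cons_cons w) h1 h2
    · obtain ⟨-, rfl⟩ := he w (mA s (by simp) hw) y (mB s' (by simp)) h1
      exact hBn.not_pair_sublist_concat ((List.sublist_cons_self x [y, z]).trans s')
  · by_cases hw : w = c
    · subst hw
      exact hAn.not_pair_sublist_concat s
    · obtain ⟨-, rfl⟩ := he w (mA s (by simp) hw) y (mB s' (by simp)) h1
      exact hBn.not_pair_sublist_concat s'
  · by_cases hx : x = c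
    · subst hx
      exact hAn.not_pair_sublist_concat ((List.sublist_cons_self w [x, y]).trans s)
    · obtain ⟨rfl, -⟩ := he x (mA s (by simp) hx) z (mB s' (by simp)) h2
      exact hA.nodup.not_pair_sublist_cons ((List.sublist_append_left [w, x] [y]).trans s)
  · exact hA.nc _ _ _ _ s h1 h2

/-- Two arrangements that share their two end vertices `u` and `v` form a circular arrangement if
there is no other edge between them. -/
theorem join_pair {u v : V} {l₁ l₂ : List V}
    (hA : G.IsArrangement (A ∪ {u, v}) (u :: (l₁ ++ [v])))
    (hB : G.IsArrangement (B ∪ {u, v}) (v :: (l₂ ++ [u]))) (hd : Disjoint A B) (huB : u ∉ B)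
    (hvB : v ∉ B) (he : ∀ x ∈ A, ∀ y ∈ B, ¬ G.Adj x y) :
    G.IsArrangement (A ∪ B ∪ {u, v}) ((u :: (l₁ ++ [v])) ++ l₂) := by
  have hBn : (l₂ ++ [u]).Nodup := (List.nodup_cons.mp hB.nodup).2
  have hvn : v ∉ l₂ ++ [u] := (List.nodup_cons.mp hB.nodup).1
  have hun : u ∉ l₂ := fun h => List.disjoint_of_nodup_append hBn h (by simp)
  have hvn' : v ∉ l₂ := fun h => hvn (List.mem_append_left _ h)
  have hB' : ∀ x, x ∈ l₂ ↔ x ∈ B := by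
    intro x
    constructor
    · intro hx
      have : x ∈ v :: (l₂ ++ [u]) := by simp [hx]
      refine ((hB.mem_iff x).mp this).resolve_right ?_
      rintro (rfl | h)
      · exact hun hx
      · exact hvn' (h ▸ hx)
    · intro hx
      have h := (hB.mem_iff x).mpr (Or.inl hx)
      simp only [List.mem_cons, List.mem_append, List.not_mem_nil, or_false] at h
      rcases h with rfl | h | rfl
      · exact absurd hx hvB
      · exact h
      · exact absurd hx huB
  refine ⟨hA.nodup.append (List.Nodup.of_append_left hBn) fun x h1 h2 => ?_, fun x => ?_, ?_⟩
  · rcases (hA.mem_iff x).mp h1 with h | rfl | h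
    · exact Set.disjoint_left.mp hd h ((hB' x).mp h2)
    · exact hun h2
    · exact hvn' (h ▸ h2)
  · rw [List.mem_append, hA.mem_iff, hB']
    simp only [Set.mem_union]; tauto
  have mA : ∀ {k : List V} {x y}, k.Sublist (u :: (l₁ ++ [v])) → x ∈ k → y ∈ l₂ → G.Adj x y →
      x = u ∨ x = v := by
    intro k x y hk hx hy hxy
    rcases (hA.mem_iff _).mp (hk.subset hx) with h | h
    · exact absurd hxy (he x h y ((hB' y).mp hy))
    · exact h
  have hAn : ((u :: l₁) ++ [v]).Nodup := hA.nodup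
  have hul : ∀ {k : List V}, k.Sublist l₂ → (v :: (k ++ [u])).Sublist (v :: (l₂ ++ [u])) :=
    fun hk => (hk.append (List.Sublist.refl _)).cons_cons v
  have hBr : G.Noncrossing (u :: v :: l₂) :=
    Noncrossing.rotate (l₁ := v :: l₂) (l₂ := [u]) hB.nc
  intro w x y z hs h1 h2
  rcases List.four_sublist_append hs with s | ⟨s, s'⟩ | ⟨s, s'⟩ | ⟨s, s'⟩ | s
  · exact hBr _ _ _ _ ((s.trans (List.sublist_cons_self ..)).trans (List.sublist_cons_self ..)) h1 h2
  · rcases mA s (by simp) (s'.subset (by simp)) h1 with rfl | rfl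
    · exact hBr _ _ _ _ ((s'.trans (List.sublist_cons_self ..)).cons_cons w) h1 h2
    · exact hBr _ _ _ _ ((s'.cons_cons w).trans (List.sublist_cons_self ..)) h1 h2
  · rcases mA s (by simp) (s'.subset (by simp)) h1 with rfl | rfl
    · rcases mA s (by simp) (s'.subset (by simp)) h2 with rfl | rfl
      · exact hA.nodup.not_pair_sublist_cons s
      · exact hBr _ _ _ _ ((s'.cons_cons x).cons_cons w) h1 h2
    · exact hAn.not_pair_sublist_concat s
  · rcases mA s (by simp) (s'.subset (by simp)) h2 with rfl | rfl
    · exact hA.nodup.not_pair_sublist_cons ((List.sublist_append_left [w, x] [y]).trans s)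
    · exact hAn.not_pair_sublist_concat ((List.sublist_cons_self w [x, y]).trans s)
  · exact hA.nc _ _ _ _ s h1 h2

end IsArrangement

end SimpleGraph

/-! ### Graphs without `K₂,₃` minor and without `K₄` have noncrossing arrangements -/

namespace SimpleGraph

variable {V : Type*} {G : SimpleGraph V}

/-- If no connected set in `T \ {a, b}` touches both `a` and `b`, then the component of `a` in
`T \ {b}` is joined to the rest of `T` at most by the edge `ab`. -/
theorem eq_of_adj_compIn {T : Set V} {a b : V} (ha : a ∈ T) (hab : a ≠ b)
    (h : ∀ X ⊆ T \ {a, b}, G.ConnOn X → G.Touches X {a} → ¬ G.Touches X {b}) :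
    ∀ u ∈ G.compIn (T \ {b}) a, ∀ v ∈ T \ G.compIn (T \ {b}) a, G.Adj u v → u = a ∧ v = b := by
  intro u hu v hv huv
  have haT : a ∈ T \ {b} := ⟨ha, hab⟩
  have hvb : v = b := by
    by_contra hvb
    exact hv.2 (mem_compIn_of_adj hu ⟨hv.1, hvb⟩ huv)
  refine ⟨?_, hvb⟩
  by_contra hua
  have hC := connOn_compIn (G := G) haT
  have hu' : u ∈ G.compIn (T \ {b}) a \ {a} := ⟨hu, hua⟩
  have ht := hC.touches_compIn (B := {a}) hu hua ⟨a, mem_compIn_self haT, rfl⟩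
  refine h _ ?_ (connOn_compIn hu') ht ⟨u, mem_compIn_self hu', v, hvb, huv⟩
  intro x hx
  have h1 := compIn_subset hx
  have h2 := compIn_subset h1.1
  exact ⟨h2.1, by
    rintro (h | h)
    · exact h1.2 h
    · exact h2.2 h⟩

/-- The condition under which `a` and `b` can be made the ends of an arrangement of `S`: they are
connected outside `S`, or they form an edge and are not connected through `S` by two disjoint
sets. -/
def EndPair (G : SimpleGraph V) (S : Set V) (a b : V) : Prop :=
  (∃ Y, G.ConnOn Y ∧ Disjoint Y S ∧ G.Touches Y {a} ∧ G.Touches Y {b}) ∨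
    (G.Adj a b ∧ ∀ X₁ ⊆ S \ {a, b}, ∀ X₂ ⊆ S \ {a, b}, Disjoint X₁ X₂ → G.ConnOn X₁ →
      G.ConnOn X₂ → G.Touches X₁ {a} → G.Touches X₁ {b} → G.Touches X₂ {a} → ¬ G.Touches X₂ {b})

/-- If `a` and `b` are connected through `S`, then some neighbour `c` of `a` separates them, and
`c` is connected to `b` by a set `Q` that avoids `a`. -/
theorem EndPair.exists_cut (hθ : ∀ A B X Y Z, ¬ G.IsTheta A B X Y Z) {S : Set V} {a b : V}
    (ha : a ∈ S) (hb : b ∈ S) (hab : a ≠ b) (h : G.EndPair S a b) {X : Set V} (hXS : X ⊆ S \ {a, b})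
    (hX : G.ConnOn X) (hXa : G.Touches X {a}) (hXb : G.Touches X {b}) :
    ∃ c ∈ S, c ≠ a ∧ c ≠ b ∧ G.Adj a c ∧
      (∃ Q ⊆ S \ {a, c}, b ∈ Q ∧ G.ConnOn Q ∧ G.Touches Q {c}) ∧
      ∀ X' ⊆ (S \ {c}) \ {a, b}, G.ConnOn X' → G.Touches X' {a} → ¬ G.Touches X' {b} := by
  -- `Q` is grown from `b` without using neighbours of `a`; `c` is the first neighbour met
  let T : Set V := {x ∈ S | x ≠ a ∧ (G.Adj a x → x = b)}
  have hbT : b ∈ T := ⟨hb, hab.symm, fun _ => rfl⟩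
  have hQ := connOn_compIn (G := G) hbT
  have hbQ : b ∈ G.compIn T b := mem_compIn_self hbT
  have hQT : G.compIn T b ⊆ T := compIn_subset
  have hXb' : G.ConnOn (X ∪ {b}) := hX.union (connOn_singleton b) hXb
  obtain ⟨x, hx, hxa⟩ := touches_singleton_right.mp hXa
  have hxQ : x ∉ G.compIn T b := fun hxQ =>
    (hXS hx).2 (Or.inr ((hQT hxQ).2.2 hxa.symm))
  obtain ⟨u, -, c, hc, huQ, hcQ, huc⟩ := hXb'.2 (G.compIn T b) b (Or.inr rfl) x (Or.inl hx) hbQ hxQ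
  have hcb : c ≠ b := fun h => hcQ (h ▸ hbQ)
  have hcX : c ∈ X := hc.resolve_right hcb
  have hcS : c ∈ S := (hXS hcX).1
  have hca : c ≠ a := fun h => (hXS hcX).2 (Or.inl h)
  have hac : G.Adj a c := by
    by_contra hac
    exact hcQ (mem_compIn_of_adj huQ ⟨hcS, hca, fun h => absurd h hac⟩ huc)
  refine ⟨c, hcS, hca, hcb, hac, ⟨G.compIn T b, ?_, hbQ, hQ, u, huQ, c, rfl, huc⟩, ?_⟩
  · intro y hy
    refine ⟨(hQT hy).1, ?_⟩
    rintro (h | h)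
    · exact (hQT hy).2.1 h
    · exact hcQ (h ▸ hy)
  clear hxQ hx hxa x
  intro X' hX'S hX' hX'a hX'b
  obtain ⟨x, hx, hxa⟩ := touches_singleton_right.mp hX'a
  have hxQ : x ∉ G.compIn T b := fun hxQ =>
    (hX'S hx).2 (Or.inr ((hQT hxQ).2.2 hxa.symm))
  generalize hQe : G.compIn T b = Q at *
  -- the part `X''` of `X'` round `x` that is not in `Q`
  have hx' : x ∈ (X' ∪ {b}) \ Q := ⟨Or.inl hx, hxQ⟩
  obtain ⟨X'', hX''e⟩ : ∃ X'', X'' = G.compIn ((X' ∪ {b}) \ Q) x := ⟨_, rfl⟩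
  have hX''s : X'' ⊆ (X' ∪ {b}) \ Q := hX''e ▸ compIn_subset
  have hX''c : G.ConnOn X'' := hX''e ▸ connOn_compIn hx'
  have hX''a : G.Touches {a} X'' := ⟨a, rfl, x, hX''e ▸ mem_compIn_self hx', hxa.symm⟩
  have hX''Q : G.Touches X'' Q := by
    rw [hX''e]
    exact (hX'.union (connOn_singleton b) hX'b).touches_compIn (Or.inl hx) hxQ ⟨b, Or.inr rfl, hbQ⟩
  have hX''X : X'' ⊆ X' := fun y hy => (hX''s hy).1.resolve_right (fun h => (hX''s hy).2 (h ▸ hbQ))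
  have haQ : a ∉ Q := fun h => (hQT h).2.1 rfl
  have hcX'' : c ∉ X'' := fun h => (hX'S (hX''X h)).1.2 rfl
  have haX'' : a ∉ X'' := fun h => (hX'S (hX''X h)).2 (Or.inl rfl)
  have hbX'' : b ∉ X'' := fun h => (hX'S (hX''X h)).2 (Or.inr rfl)
  have hQX'' : Disjoint Q X'' := Set.disjoint_left.mpr fun y h1 h2 => (hX''s h2).2 h1
  rcases h with ⟨Y, hY, hYS, hYa, hYb⟩ | ⟨hadj, hno⟩
  · have hd : ∀ y ∈ Y, y ∉ S := fun y hy => Set.disjoint_left.mp hYS hy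
    have haY : a ∉ Y := fun h => hd a h ha
    exact hθ {a} Q {c} X'' Y
      { cA := connOn_singleton _, cB := hQ, cX := connOn_singleton _, cY := hX''c, cZ := hY
        dAB := by simpa using haQ
        dAX := by simpa using hca.symm
        dAY := by simpa using haX''
        dAZ := by simpa using haY
        dBX := by simpa using hcQ
        dBY := hQX''
        dBZ := Set.disjoint_left.mpr fun y h1 h2 => hd y h2 (hQT h1).1
        dXY := by simpa using hcX''
        dXZ := Set.disjoint_left.mpr fun y h1 h2 => hd y h2 (by
          rw [Set.mem_singleton_iff] at h1; exact h1 ▸ hcS)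
        dYZ := Set.disjoint_left.mpr fun y h1 h2 => hd y h2 (hX'S (hX''X h1)).1.1
        tAX := touches_singleton.mpr hac
        tAY := hX''a
        tAZ := hYa.symm
        tBX := ⟨u, huQ, c, rfl, huc⟩
        tBY := hX''Q.symm
        tBZ := hYb.symm.mono (by simpa using hbQ) subset_rfl }
  · -- `c` and `X''` reach `b` through `Q`, separately or together
    have reach : ∀ W, G.ConnOn W → G.Touches W Q →
        G.Touches W {b} ∨ ∃ K ⊆ Q \ {b}, G.ConnOn K ∧ G.Touches W K ∧ G.Touches K {b} ∧
          ∃ q, K = G.compIn (Q \ {b}) q := by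
      rintro W hW ⟨w, hw, q, hq, hwq⟩
      by_cases hqb : q = b
      · exact Or.inl ⟨w, hw, q, hqb, hwq⟩
      · have hq' : q ∈ Q \ {b} := ⟨hq, hqb⟩
        exact Or.inr ⟨G.compIn (Q \ {b}) q, compIn_subset, connOn_compIn hq',
          ⟨w, hw, q, mem_compIn_self hq', hwq⟩, hQ.touches_compIn hq hqb ⟨b, hbQ, rfl⟩, q, rfl⟩
    have hQsub : Q \ {b} ⊆ S \ {a, b} := fun y hy => ⟨(hQT hy.1).1, by
      rintro (h | h)
      · exact (hQT hy.1).2.1 h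
      · exact hy.2 h⟩
    have hcsub : {c} ⊆ S \ {a, b} := by
      rintro y rfl
      exact ⟨hcS, by rintro (h | h); exacts [hca h, hcb h]⟩
    have hXsub : X'' ⊆ S \ {a, b} := fun y hy => ⟨(hX'S (hX''X hy)).1.1, (hX'S (hX''X hy)).2⟩
    have hcX''d : Disjoint {c} X'' := by simpa using hcX''
    have hcQd : Disjoint {c} Q := by simpa using hcQ
    have hac' : G.Touches {c} {a} := touches_singleton.mpr hac.symm
    rcases reach {c} (connOn_singleton c) ⟨c, rfl, u, huQ, huc.symm⟩ with
      h1 | ⟨K₁, hK₁Q, hK₁, hcK₁, hK₁b, q₁, hq₁⟩ <;>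
    rcases reach X'' hX''c hX''Q with h2 | ⟨K₂, hK₂Q, hK₂, hXK₂, hK₂b, q₂, hq₂⟩
    · exact hno _ hcsub _ hXsub hcX''d (connOn_singleton c) hX''c hac' h1 hX''a.symm h2
    · refine hno {c} hcsub (X'' ∪ K₂) (Set.union_subset hXsub (hK₂Q.trans hQsub)) ?_
        (connOn_singleton c) (hX''c.union hK₂ hXK₂) hac' h1
        (touches_union_left.mpr (Or.inl hX''a.symm)) (touches_union_left.mpr (Or.inr hK₂b))
      exact hcX''d.union_right (hcQd.mono_right (hK₂Q.trans Set.sdiff_subset))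
    · refine hno ({c} ∪ K₁) (Set.union_subset hcsub (hK₁Q.trans hQsub)) X'' hXsub ?_
        ((connOn_singleton c).union hK₁ hcK₁) hX''c (touches_union_left.mpr (Or.inl hac'))
        (touches_union_left.mpr (Or.inr hK₁b)) hX''a.symm h2
      exact hcX''d.union_left (hQX''.mono_left (hK₁Q.trans Set.sdiff_subset))
    · by_cases hd : Disjoint K₁ K₂
      · refine hno ({c} ∪ K₁) (Set.union_subset hcsub (hK₁Q.trans hQsub)) (X'' ∪ K₂)
          (Set.union_subset hXsub (hK₂Q.trans hQsub)) ?_ ((connOn_singleton c).union hK₁ hcK₁)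
          (hX''c.union hK₂ hXK₂) (touches_union_left.mpr (Or.inl hac'))
          (touches_union_left.mpr (Or.inr hK₁b)) (touches_union_left.mpr (Or.inl hX''a.symm))
          (touches_union_left.mpr (Or.inr hK₂b))
        exact Disjoint.union_left
          (hcX''d.union_right (hcQd.mono_right (hK₂Q.trans Set.sdiff_subset)))
          ((hQX''.mono_left (hK₁Q.trans Set.sdiff_subset)).union_right hd)
      · obtain ⟨k, hk1, hk2⟩ := Set.not_disjoint_iff.mp hd
        have hK₂₁ : K₂ ⊆ K₁ := by
          subst hq₁
          exact hK₂.subset_compIn hK₂Q hk2 hk1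
        have haK : a ∉ K₁ := fun h => (hQsub (hK₁Q h)).2 (Or.inl rfl)
        exact hθ {a} K₁ {c} X'' {b}
          { cA := connOn_singleton _, cB := hK₁, cX := connOn_singleton _, cY := hX''c
            cZ := connOn_singleton _
            dAB := by simpa using haK
            dAX := by simpa using hca.symm
            dAY := by simpa using haX''
            dAZ := by simpa using hab
            dBX := (hcQd.mono_right (hK₁Q.trans Set.sdiff_subset)).symm
            dBY := hQX''.mono_left (hK₁Q.trans Set.sdiff_subset)
            dBZ := by
              rw [Set.disjoint_singleton_right]
              exact fun h => (hK₁Q h).2 rfl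
            dXY := hcX''d
            dXZ := by simpa using hcb
            dYZ := by simpa using hbX''
            tAX := touches_singleton.mpr hac
            tAY := hX''a
            tAZ := touches_singleton.mpr hadj
            tBX := hcK₁.symm
            tBY := (hXK₂.mono subset_rfl hK₂₁).symm
            tBZ := hK₁b }

/-- The induction step for arrangements with prescribed ends: either `a` and `b` are not connected
through `S`, and the component of `a` is arranged before the rest, or `S` is split at a cut
vertex `c`. -/
theorem EndPair.exists_arrangement [Finite V] (hθ : ∀ A B X Y Z, ¬ G.IsTheta A B X Y Z)
    {S : Set V} {a b : V} (ha : a ∈ S) (hb : b ∈ S) (hab : a ≠ b) (h : G.EndPair S a b)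
    (hR : ∀ T : Set V, T.ncard < S.ncard → ∃ l, G.IsArrangement T l)
    (hE : ∀ (T : Set V) (a b : V), T.ncard < S.ncard → a ∈ T → b ∈ T → a ≠ b → G.EndPair T a b →
      ∃ l, G.IsArrangement T (a :: (l ++ [b]))) :
    ∃ l, G.IsArrangement S (a :: (l ++ [b])) := by
  have hlt : ∀ {T : Set V} {x : V}, T ⊆ S → x ∈ S → x ∉ T → T.ncard < S.ncard :=
    fun hT hx hxT => Set.ncard_lt_ncard ⟨hT, fun hc => hxT (hc hx)⟩
  by_cases hX : ∀ X ⊆ S \ {a, b}, G.ConnOn X → G.Touches X {a} → ¬ G.Touches X {b}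
  · have he := eq_of_adj_compIn ha hab hX
    have haA : a ∈ G.compIn (S \ {b}) a := mem_compIn_self ⟨ha, hab⟩
    have hAS : G.compIn (S \ {b}) a ⊆ S \ {b} := compIn_subset
    generalize G.compIn (S \ {b}) a = A at he haA hAS
    have hbA : b ∉ A := fun h => (hAS h).2 rfl
    have hAS' : A ⊆ S := hAS.trans Set.sdiff_subset
    obtain ⟨l₁, h₁⟩ := hR A (hlt hAS' hb hbA)
    obtain ⟨l₂, h₂⟩ := hR (S \ A) (hlt Set.sdiff_subset ha fun h => h.2 haA)
    obtain ⟨l₁, h₁⟩ := h₁.exists_cons haA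
    obtain ⟨l₂, h₂⟩ := h₂.exists_concat (b := b) ⟨hb, hbA⟩
    have := h₁.append h₂ Set.disjoint_sdiff_right he
    rw [Set.union_sdiff_cancel hAS'] at this
    exact ⟨_, this⟩
  · push Not at hX
    obtain ⟨X, hXS, hXc, hXa, hXb⟩ := hX
    obtain ⟨c, hcS, hca, hcb, hac, ⟨Q, hQS, hbQ, hQ, hQc⟩, hcut⟩ :=
      h.exists_cut hθ ha hb hab hXS hXc hXa hXb
    have haT : a ∈ S \ {c} := ⟨ha, hca.symm⟩
    have he := eq_of_adj_compIn haT hab hcut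
    have haA : a ∈ G.compIn ((S \ {c}) \ {b}) a := mem_compIn_self ⟨haT, hab⟩
    have hAS : G.compIn ((S \ {c}) \ {b}) a ⊆ (S \ {c}) \ {b} := compIn_subset
    generalize G.compIn ((S \ {c}) \ {b}) a = A at he haA hAS
    have hbA : b ∉ A := fun h => (hAS h).2 rfl
    have hcA : c ∉ A := fun h => (hAS h).1.2 rfl
    have hAS' : A ⊆ S := fun x hx => (hAS hx).1.1
    have hBS : (S \ {c}) \ A ⊆ S := fun x hx => hx.1.1
    have hcs : {c} ⊆ S := by simpa using hcS
    have hbB : b ∈ (S \ {c}) \ A := ⟨⟨hb, hcb.symm⟩, hbA⟩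
    -- `Q` lies on the side of `b`, since the only edge that leaves `A` starts at `a`
    have hQA : Disjoint Q (A ∪ {c}) := by
      rw [Set.disjoint_left]
      rintro q hq (hqA | hqc)
      · obtain ⟨u, huQ, v, hvQ, huA, hvA, huv⟩ := hQ.2 A q hq b hbQ hqA hbA
        have hv := hQS hvQ
        obtain ⟨rfl, -⟩ := he u huA v ⟨⟨hv.1, fun h => hv.2 (Or.inr h)⟩, hvA⟩ huv
        exact (hQS huQ).2 (Or.inl rfl)
      · exact (hQS hq).2 (Or.inr hqc)
    have hEA : G.EndPair (A ∪ {c}) a c := by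
      refine Or.inl ?_
      rcases h with ⟨Y, hY, hYS, hYa, hYb⟩ | ⟨hadj, -⟩
      · exact ⟨Y ∪ Q, hY.union hQ (hYb.mono subset_rfl (by simpa using hbQ)),
          Disjoint.union_left (hYS.mono_right (Set.union_subset hAS' hcs)) hQA,
          touches_union_left.mpr (Or.inl hYa), touches_union_left.mpr (Or.inr hQc)⟩
      · exact ⟨Q, hQ, hQA, ⟨b, hbQ, a, rfl, hadj.symm⟩, hQc⟩
    have haB : Disjoint {a} ((S \ {c}) \ A ∪ {c}) := by
      rw [Set.disjoint_singleton_left]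
      rintro (h | h)
      · exact h.2 haA
      · exact hca h.symm
    have hEB : G.EndPair ((S \ {c}) \ A ∪ {c}) c b := by
      refine Or.inl ?_
      rcases h with ⟨Y, hY, hYS, hYa, hYb⟩ | ⟨hadj, -⟩
      · exact ⟨Y ∪ {a}, hY.union (connOn_singleton a) hYa,
          Disjoint.union_left (hYS.mono_right (Set.union_subset hBS hcs)) haB,
          touches_union_left.mpr (Or.inr (touches_singleton.mpr hac)),
          touches_union_left.mpr (Or.inl hYb)⟩
      · exact ⟨{a}, connOn_singleton a, haB, touches_singleton.mpr hac, touches_singleton.mpr hadj⟩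
    obtain ⟨l₁, h₁⟩ := hE (A ∪ {c}) a c
      (hlt (Set.union_subset hAS' hcs) hb (by rintro (h | h); exacts [hbA h, hcb h.symm]))
      (Or.inl haA) (Or.inr rfl) hca.symm hEA
    obtain ⟨l₂, h₂⟩ := hE ((S \ {c}) \ A ∪ {c}) c b
      (hlt (Set.union_subset hBS hcs) ha (Set.disjoint_singleton_left.mp haB))
      (Or.inr rfl) (Or.inl hbB) hcb hEB
    have := h₁.join_vertex h₂ Set.disjoint_sdiff_right (fun h => h.1.2 rfl) he
    rw [Set.union_sdiff_cancel (fun x hx => (hAS hx).1), Set.sdiff_union_of_subset hcs] at this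
    exact ⟨_, this⟩

/-- The induction step for arrangements of `S`. An edge `uv` provides the ends unless `u`
and `v` are connected through `S` by two disjoint sets; in this case it separates these sets, since
there is no `K₄`, and the two parts of `S` are arranged on either side of it. -/
theorem exists_arrangement_of_endPair [Finite V] (hθ : ∀ A B X Y Z, ¬ G.IsTheta A B X Y Z)
    (hK : ∀ a b c d, ¬ G.IsK4Minor {a} {b} {c} {d}) (S : Set V)
    (hE : ∀ (T : Set V) (a b : V), T ⊆ S → a ∈ T → b ∈ T → a ≠ b → G.EndPair T a b →
      ∃ l, G.IsArrangement T (a :: (l ++ [b]))) :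
    ∃ l, G.IsArrangement S l := by
  by_cases hedge : ∃ u ∈ S, ∃ v ∈ S, G.Adj u v
  swap
  · push Not at hedge
    refine ⟨S.toFinite.toFinset.toList, Finset.nodup_toList _, by simp, ?_⟩
    intro w x y z hs h
    have : ∀ t ∈ [w, x, y, z], t ∈ S := fun t ht => by simpa using hs.subset ht
    exact absurd h (hedge w (this w (by simp)) y (this y (by simp)))
  obtain ⟨u, hu, v, hv, huv⟩ := hedge
  by_cases hX : ∀ X₁ ⊆ S \ {u, v}, ∀ X₂ ⊆ S \ {u, v}, Disjoint X₁ X₂ → G.ConnOn X₁ →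
      G.ConnOn X₂ → G.Touches X₁ {u} → G.Touches X₁ {v} → G.Touches X₂ {u} → ¬ G.Touches X₂ {v}
  · obtain ⟨l, hl⟩ := hE S u v subset_rfl hu hv huv.ne (Or.inr ⟨huv, hX⟩)
    exact ⟨_, hl⟩
  push Not at hX
  obtain ⟨X₁, hX₁S, X₂, hX₂S, hd, hX₁, hX₂, h₁u, h₁v, h₂u, h₂v⟩ := hX
  obtain ⟨x, hx⟩ := hX₁.1
  have hxS := hX₁S hx
  have hD := connOn_compIn (G := G) hxS
  have hXD : X₁ ⊆ G.compIn (S \ {u, v}) x := hX₁.subset_compIn hX₁S hx (mem_compIn_self hxS)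
  have hDS : G.compIn (S \ {u, v}) x ⊆ S \ {u, v} := compIn_subset
  have huvS : {u, v} ⊆ S := by rintro y (rfl | rfl); exacts [hu, hv]
  by_cases h2D : Disjoint X₂ (G.compIn (S \ {u, v}) x)
  · have he : ∀ y ∈ G.compIn (S \ {u, v}) x, ∀ z ∈ (S \ {u, v}) \ G.compIn (S \ {u, v}) x,
        ¬ G.Adj y z := fun y hy z hz hyz => hz.2 (mem_compIn_of_adj hy hz.1 hyz)
    generalize G.compIn (S \ {u, v}) x = D at *
    have hD' : D ∪ {u, v} ⊆ S := Set.union_subset (hDS.trans Set.sdiff_subset) huvS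
    have hB' : (S \ {u, v}) \ D ∪ {u, v} ⊆ S := Set.union_subset (fun y hy => hy.1.1) huvS
    obtain ⟨l₁, h₁⟩ := hE (D ∪ {u, v}) u v hD' (by simp) (by simp) huv.ne
      (Or.inl ⟨X₂, hX₂, h2D.union_right (Set.disjoint_left.mpr fun y hy => (hX₂S hy).2), h₂u, h₂v⟩)
    obtain ⟨l₂, h₂⟩ := hE ((S \ {u, v}) \ D ∪ {u, v}) v u hB' (by simp) (by simp) huv.ne.symm
      (Or.inl ⟨X₁, hX₁, Disjoint.union_right
        (Set.disjoint_left.mpr fun y hy hy' => hy'.2 (hXD hy))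
        (Set.disjoint_left.mpr fun y hy => (hX₁S hy).2), h₁v, h₁u⟩)
    have := h₁.join_pair h₂ Set.disjoint_sdiff_right (fun h => h.1.2 (by simp))
      (fun h => h.1.2 (by simp)) he
    rw [Set.union_sdiff_cancel hDS, Set.sdiff_union_of_subset huvS] at this
    exact ⟨_, this⟩
  · -- now `u`, `v`, `X₂` and a set that extends `X₁` up to `X₂` form a `K₄` minor
    exfalso
    have hX₂D : X₂ ⊆ G.compIn (S \ {u, v}) x := by
      obtain ⟨y, hy, hyD⟩ := Set.not_disjoint_iff.mp h2D
      exact hX₂.subset_compIn hX₂S hy hyD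
    generalize G.compIn (S \ {u, v}) x = D at *
    have hx2 : x ∉ X₂ := fun h => Set.disjoint_left.mp hd hx h
    have hxD : x ∈ D \ X₂ := ⟨hXD hx, hx2⟩
    have hW := connOn_compIn (G := G) hxD
    obtain ⟨y, hy⟩ := hX₂.1
    have hWt := hD.touches_compIn (B := X₂) (hXD hx) hx2 ⟨y, hX₂D hy, hy⟩
    have hWs : G.compIn (D \ X₂) x ⊆ D \ X₂ := compIn_subset
    have hXW : X₁ ⊆ G.compIn (D \ X₂) x :=
      hX₁.subset_compIn (fun y hy => ⟨hXD hy, Set.disjoint_left.mp hd hy⟩) hx (mem_compIn_self hxD)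
    generalize G.compIn (D \ X₂) x = W at *
    have huW : u ∉ W := fun h => (hDS (hWs h).1).2 (by simp)
    have hvW : v ∉ W := fun h => (hDS (hWs h).1).2 (by simp)
    have hu2 : u ∉ X₂ := fun h => (hX₂S h).2 (by simp)
    have hv2 : v ∉ X₂ := fun h => (hX₂S h).2 (by simp)
    have hmin : G.IsK4Minor W {u} {v} X₂ :=
      { cA := hW, cB := connOn_singleton u, cC := connOn_singleton v, cD := hX₂
        dAB := by simpa using huW
        dAC := by simpa using hvW
        dAD := Set.disjoint_left.mpr fun y hy => (hWs hy).2
        dBC := by simpa using huv.ne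
        dBD := by simpa using hu2
        dCD := by simpa using hv2
        tAB := h₁u.mono hXW subset_rfl
        tAC := h₁v.mono hXW subset_rfl
        tAD := hWt
        tBC := touches_singleton.mpr huv
        tBD := h₂u.symm
        tCD := h₂v.symm }
    obtain ⟨w, -, h1⟩ := hmin.exists_singleton_left hθ
    obtain ⟨z, -, h2⟩ := h1.rotate.rotate.rotate.exists_singleton_left hθ
    exact hK _ _ _ _ h2

/-- A finite graph without `K₂,₃` minor and without complete subgraph on four vertices has a
noncrossing arrangement. -/
theorem exists_arrangement [Finite V] (hθ : ∀ A B X Y Z, ¬ G.IsTheta A B X Y Z)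
    (hK : ∀ a b c d, ¬ G.IsK4Minor {a} {b} {c} {d}) : ∃ l, G.IsArrangement Set.univ l := by
  have main : ∀ (n : ℕ) (S : Set V), S.ncard = n → (∃ l, G.IsArrangement S l) ∧
      ∀ a b, a ∈ S → b ∈ S → a ≠ b → G.EndPair S a b →
        ∃ l, G.IsArrangement S (a :: (l ++ [b])) := by
    intro n
    induction n using Nat.strong_induction_on with
    | _ n ih =>
      have hE : ∀ S : Set V, S.ncard = n → ∀ a b, a ∈ S → b ∈ S → a ≠ b → G.EndPair S a b →
          ∃ l, G.IsArrangement S (a :: (l ++ [b])) := by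
        rintro S rfl a b ha hb hab h
        exact h.exists_arrangement hθ ha hb hab (fun T hT => (ih _ hT T rfl).1)
          (fun T a b hT => (ih _ hT T rfl).2 a b)
      rintro S rfl
      refine ⟨exists_arrangement_of_endPair hθ hK S fun T a b hT => ?_, hE S rfl⟩
      rcases (Set.ncard_le_ncard hT).lt_or_eq with h | h
      · exact (ih _ h T rfl).2 a b
      · exact hE T h a b
  exact (main _ Set.univ rfl).1

end SimpleGraph

/-! ### Outerplanar drawings have no `K₂,₃` and no `K₄` -/

section

open Set Topology

/-- The theta curve lemma in the Euclidean plane. -/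
theorem Plane.no_theta_curve {p q : Plane} (hpq : p ≠ q) (P : Fin 3 → Set Plane)
    (hcl : ∀ i, IsClosed (P i)) (hP : ∀ i, JoinedIn (P i) q p)
    (hconn : ∀ i, IsPreconnected (P i \ {p, q}))
    (hdisj : ∀ i j, i ≠ j → P i ∩ P j ⊆ {p, q}) {F : Set Plane} (hF : IsPreconnected F)
    (hFP : ∀ i, Disjoint F (P i)) (hFcl : ∀ i, (closure F ∩ (P i \ {p, q})).Nonempty) : False := by
  let e : Plane ≃ₜ ℂ := Complex.orthonormalBasisOneI.repr.symm.toHomeomorph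
  have him : ∀ A : Set Plane, e '' (A \ {p, q}) = (e '' A) \ {e p, e q} := fun A => by
    rw [image_sdiff e.injective, image_pair]
  refine _root_.no_theta_curve (p := e p) (q := e q) (e.injective.ne hpq) (fun i => e '' P i)
    (fun i => e.isClosedMap _ (hcl i)) (fun i => ?_) (fun i => ?_) (fun i j hij => ?_)
    (F := e '' F) (hF.image _ e.continuous.continuousOn)
    (fun i => (disjoint_image_iff e.injective).mpr (hFP i)) (fun i => ?_)
  · exact (hP i).map_continuousOn e.continuous.continuousOn
  · rw [← him]
    exact (hconn i).image _ e.continuous.continuousOn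
  · rw [← image_inter e.injective, ← image_pair]
    exact image_mono (hdisj i j hij)
  · rw [← him, ← e.image_closure, ← image_inter e.injective]
    exact (hFcl i).image _

theorem IsSimpleArc.joinedIn {A : Set Plane} {p q : Plane} (h : IsSimpleArc A p q) :
    JoinedIn A p q := by
  obtain ⟨γ, -, rfl⟩ := h
  exact ⟨γ, fun t => mem_range_self t⟩

theorem IsSimpleArc.isClosed {A : Set Plane} {p q : Plane} (h : IsSimpleArc A p q) :
    IsClosed A := by
  obtain ⟨γ, -, rfl⟩ := h
  exact (isCompact_range γ.continuous).isClosed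

theorem IsSimpleArc.isPreconnected {A : Set Plane} {p q : Plane} (h : IsSimpleArc A p q) :
    IsPreconnected A := by
  obtain ⟨γ, -, rfl⟩ := h
  exact isPreconnected_range γ.continuous

theorem IsSimpleArc.infinite {A : Set Plane} {p q : Plane} (h : IsSimpleArc A p q) :
    A.Infinite := by
  obtain ⟨γ, hγ, rfl⟩ := h
  have : Infinite unitInterval := (Icc_infinite zero_lt_one).to_subtype
  exact infinite_range_of_injective hγ

theorem IsSimpleArc.isPreconnected_diff_left {A : Set Plane} {p q : Plane} (h : IsSimpleArc A p q) :
    IsPreconnected (A \ {p}) := by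
  obtain ⟨γ, hγ, rfl⟩ := h
  have : range γ \ {p} = γ '' Ioi 0 := by
    ext x
    constructor
    · rintro ⟨⟨t, rfl⟩, ht⟩
      refine ⟨t, ?_, rfl⟩
      rw [mem_Ioi, unitInterval.pos_iff_ne_zero]
      rintro rfl
      exact ht γ.source
    · rintro ⟨t, ht, rfl⟩
      refine ⟨mem_range_self t, fun h => ?_⟩
      have h : γ t = γ 0 := by rw [γ.source]; exact h
      exact (mem_Ioi.mp ht).ne' (hγ h)
  rw [this]
  exact isPreconnected_Ioi.image _ γ.continuous.continuousOn

theorem IsSimpleArc.isPreconnected_diff_pair {A : Set Plane} {p q : Plane}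
    (h : IsSimpleArc A p q) : IsPreconnected (A \ {p, q}) := by
  obtain ⟨γ, hγ, rfl⟩ := h
  have : range γ \ {p, q} = γ '' Ioo 0 1 := by
    ext x
    constructor
    · rintro ⟨⟨t, rfl⟩, ht⟩
      refine ⟨t, ⟨?_, ?_⟩, rfl⟩
      · rw [unitInterval.pos_iff_ne_zero]
        rintro rfl
        exact ht (Or.inl γ.source)
      · rw [unitInterval.lt_one_iff_ne_one]
        rintro rfl
        exact ht (Or.inr γ.target)
    · rintro ⟨t, ht, rfl⟩
      refine ⟨mem_range_self t, ?_⟩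
      rintro (h | h)
      · have h : γ t = γ 0 := by rw [γ.source]; exact h
        exact ht.1.ne' (hγ h)
      · have h : γ t = γ 1 := by rw [γ.target]; exact h
        exact ht.2.ne (hγ h)
  rw [this]
  exact isPreconnected_Ioo.image _ γ.continuous.continuousOn

namespace PlaneEmbedding

variable {V : Type*} {G : SimpleGraph V} (D : PlaneEmbedding G)

/-- The union of the arcs of a set of edges. -/
def arcs (E : Set G.edgeSet) : Set Plane := ⋃ e ∈ E, D.arc e

theorem arc_subset_arcs {E : Set G.edgeSet} {e : G.edgeSet} (he : e ∈ E) : D.arc e ⊆ D.arcs E :=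
  subset_biUnion_of_mem (u := fun e => D.arc e) he

theorem isClosed_arc (e : G.edgeSet) : IsClosed (D.arc e) := by
  obtain ⟨e, he⟩ := e
  induction e using Sym2.ind with
  | _ u v => exact (D.arc_isSimpleArc u v he).isClosed

theorem isClosed_arcs [Finite V] (E : Set G.edgeSet) : IsClosed (D.arcs E) :=
  (toFinite E).isClosed_biUnion fun e _ => D.isClosed_arc e

theorem pos_mem_arc {u v : V} (h : G.Adj u v) :
    D.pos u ∈ D.arc ⟨s(u, v), h⟩ ∧ D.pos v ∈ D.arc ⟨s(u, v), h⟩ :=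
  ⟨(D.arc_isSimpleArc u v h).joinedIn.source_mem, (D.arc_isSimpleArc u v h).joinedIn.target_mem⟩

/-- The theta curve lemma for sets `E i` of edges that share only the vertices `p` and `q`; the set
`W i` holds the other vertices of `E i`. -/
theorem no_theta_edges [Finite V] {p q : V} (hpq : p ≠ q) (E : Fin 3 → Set G.edgeSet)
    (W : Fin 3 → Set V) (hE : ∀ i, ∀ e ∈ E i, ∀ v ∈ (e : Sym2 V), v ∈ W i ∨ v = p ∨ v = q)
    (hW : ∀ i j, i ≠ j → Disjoint (W i) (W j)) (hpW : ∀ i, p ∉ W i) (hqW : ∀ i, q ∉ W i)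
    (hEd : ∀ i j, i ≠ j → Disjoint (E i) (E j))
    (hP : ∀ i, JoinedIn (D.arcs (E i)) (D.pos q) (D.pos p))
    (hconn : ∀ i, IsPreconnected (D.arcs (E i) \ {D.pos p, D.pos q}))
    {F : Set Plane} (hF : IsPreconnected F) (hFP : ∀ i, Disjoint F (D.arcs (E i)))
    (hFcl : ∀ i, (closure F ∩ (D.arcs (E i) \ {D.pos p, D.pos q})).Nonempty) : False := by
  refine Plane.no_theta_curve (D.pos_injective.ne hpq) (fun i => D.arcs (E i))
    (fun i => D.isClosed_arcs _) hP hconn (fun i j hij => ?_) hF hFP hFcl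
  rintro x ⟨hx, hy⟩
  simp only [arcs, mem_iUnion, exists_prop] at hx hy
  obtain ⟨e, he, hxe⟩ := hx
  obtain ⟨f, hf, hxf⟩ := hy
  obtain ⟨v, rfl⟩ := D.arc_inter_arc e f (fun h => disjoint_left.mp (hEd i j hij) he (h ▸ hf))
    ⟨hxe, hxf⟩
  rcases hE i e he v (D.mem_of_pos_mem_arc v e hxe) with h1 | rfl | rfl
  · rcases hE j f hf v (D.mem_of_pos_mem_arc v f hxf) with h2 | rfl | rfl
    · exact absurd h2 (disjoint_left.mp (hW i j hij) h1)
    · exact absurd h1 (hpW i)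
    · exact absurd h1 (hqW i)
  · exact Or.inl rfl
  · exact Or.inr rfl

/-- The edges within `X` together with the edges `px` and `qy`. -/
def _root_.SimpleGraph.linkEdges (G : SimpleGraph V) (p q x y : V) (X : Set V) : Set G.edgeSet :=
  {e | (e : Sym2 V) = s(p, x) ∨ (e : Sym2 V) = s(q, y) ∨ ∃ u ∈ X, ∃ v ∈ X, (e : Sym2 V) = s(u, v)}

theorem _root_.SimpleGraph.mem_or_of_mem_linkEdges {p q x y : V} {X : Set V} (hx : x ∈ X)
    (hy : y ∈ X) {e : G.edgeSet} (he : e ∈ G.linkEdges p q x y X) {v : V}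
    (hv : v ∈ (e : Sym2 V)) : v ∈ X ∨ v = p ∨ v = q := by
  rcases he with h | h | ⟨u, hu, w, hw, h⟩ <;> rw [h, Sym2.mem_iff] at hv <;>
    rcases hv with rfl | rfl <;> tauto

theorem _root_.SimpleGraph.exists_mem_of_mem_linkEdges {p q x y : V} {X : Set V} (hx : x ∈ X)
    (hy : y ∈ X) {e : G.edgeSet} (he : e ∈ G.linkEdges p q x y X) :
    ∃ v ∈ (e : Sym2 V), v ∈ X := by
  rcases he with h | h | ⟨u, hu, w, hw, h⟩ <;> rw [h]
  · exact ⟨x, by simp, hx⟩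
  · exact ⟨y, by simp, hy⟩
  · exact ⟨u, by simp, hu⟩

/-- The drawing of a connected set `X` with two edges `px` and `qy` joins `p` to `q`, and is
connected also without the points of `p` and `q`. -/
theorem linkEdges_connected {p q x y : V} {X : Set V} (hX : G.ConnOn X) (hx : x ∈ X) (hy : y ∈ X)
    (hpX : p ∉ X) (hqX : q ∉ X) (hpq : p ≠ q) (hpx : G.Adj p x) (hqy : G.Adj q y) :
    JoinedIn (D.arcs (G.linkEdges p q x y X)) (D.pos q) (D.pos p) ∧
      IsPreconnected (D.arcs (G.linkEdges p q x y X) \ {D.pos p, D.pos q}) ∧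
      ∀ v ∈ X, D.pos v ∈ D.arcs (G.linkEdges p q x y X) \ {D.pos p, D.pos q} := by
  set E := G.linkEdges p q x y X with hEdef
  set C := D.arcs E \ {D.pos p, D.pos q} with hC
  have hpE : (⟨s(p, x), hpx⟩ : G.edgeSet) ∈ E := Or.inl rfl
  have hqE : (⟨s(q, y), hqy⟩ : G.edgeSet) ∈ E := Or.inr (Or.inl rfl)
  have hXE : ∀ {u v : V} (h : G.Adj u v), u ∈ X → v ∈ X → (⟨s(u, v), h⟩ : G.edgeSet) ∈ E :=
    fun h hu hv => Or.inr (Or.inr ⟨_, hu, _, hv, rfl⟩)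
  have hnot : ∀ {w : V} {e : G.edgeSet}, w ∉ (e : Sym2 V) → D.pos w ∉ D.arc e :=
    fun hw h => hw (D.mem_of_pos_mem_arc _ _ h)
  have harcX : ∀ {u v : V} (h : G.Adj u v), u ∈ X → v ∈ X → D.arc ⟨s(u, v), h⟩ ⊆ C := by
    intro u v h hu hv z hz
    refine ⟨D.arc_subset_arcs (hXE h hu hv) hz, ?_⟩
    rintro (rfl | rfl)
    · refine hnot (w := p) ?_ hz
      rw [Sym2.mem_iff]; rintro (rfl | rfl) <;> contradiction
    · refine hnot (w := q) ?_ hz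
      rw [Sym2.mem_iff]; rintro (rfl | rfl) <;> contradiction
  have harcp : D.arc ⟨s(p, x), hpx⟩ \ {D.pos p} ⊆ C := by
    rintro z ⟨hz, hzp⟩
    refine ⟨D.arc_subset_arcs hpE hz, ?_⟩
    rintro (rfl | rfl)
    · exact hzp rfl
    · refine hnot (w := q) ?_ hz
      rw [Sym2.mem_iff]; rintro (rfl | rfl) <;> contradiction
  have harcq : D.arc ⟨s(q, y), hqy⟩ \ {D.pos q} ⊆ C := by
    rintro z ⟨hz, hzp⟩
    refine ⟨D.arc_subset_arcs hqE hz, ?_⟩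
    rintro (rfl | rfl)
    · refine hnot (w := p) ?_ hz
      rw [Sym2.mem_iff]; rintro (rfl | rfl) <;> contradiction
    · exact hzp rfl
  have hxp : D.pos x ∈ D.arc ⟨s(p, x), hpx⟩ \ {D.pos p} :=
    ⟨(D.pos_mem_arc hpx).2, fun h => hpX (D.pos_injective h ▸ hx)⟩
  have hyq : D.pos y ∈ D.arc ⟨s(q, y), hqy⟩ \ {D.pos q} :=
    ⟨(D.pos_mem_arc hqy).2, fun h => hqX (D.pos_injective h ▸ hy)⟩
  have hjoin : ∀ v ∈ X, JoinedIn C (D.pos x) (D.pos v) := by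
    by_contra hcon
    push Not at hcon
    obtain ⟨v, hv, hvn⟩ := hcon
    obtain ⟨u, hu, w, hw, huA, hwA, huw⟩ := hX.2 {u | JoinedIn C (D.pos x) (D.pos u)} x hx v hv
      (JoinedIn.refl (harcp hxp)) hvn
    exact hwA (huA.trans ((D.arc_isSimpleArc u w huw).joinedIn.mono (harcX huw hu hw)))
  refine ⟨?_, ?_, fun v hv => (hjoin v hv).target_mem⟩
  · have h1 := (D.arc_isSimpleArc q y hqy).joinedIn.mono (D.arc_subset_arcs hqE)
    have h2 := (hjoin y hy).mono sdiff_subset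
    have h3 := (D.arc_isSimpleArc p x hpx).joinedIn.mono (D.arc_subset_arcs hpE)
    exact (h1.trans h2.symm).trans h3.symm
  · have hpath : ∀ v ∈ X, ∃ t ⊆ C, D.pos x ∈ t ∧ D.pos v ∈ t ∧ IsPreconnected t := by
      intro v hv
      obtain ⟨γ, hγ⟩ := hjoin v hv
      exact ⟨range γ, range_subset_iff.mpr hγ, ⟨0, γ.source⟩, ⟨1, γ.target⟩,
        isPreconnected_range γ.continuous⟩
    refine isPreconnected_of_forall (D.pos x) fun z hz => ?_
    obtain ⟨hzE, hzn⟩ := hz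
    simp only [arcs, mem_iUnion, exists_prop] at hzE
    obtain ⟨⟨e, he⟩, heE, hze⟩ := hzE
    rcases heE with h | h | ⟨u, hu, w, hw, h⟩ <;> simp only at h <;> subst h
    · exact ⟨_, harcp, hxp, ⟨hze, fun h => hzn (Or.inl h)⟩,
        (D.arc_isSimpleArc p x hpx).isPreconnected_diff_left⟩
    · obtain ⟨t, htC, htx, hty, ht⟩ := hpath y hy
      exact ⟨t ∪ (D.arc ⟨s(q, y), hqy⟩ \ {D.pos q}), union_subset htC harcq, Or.inl htx,
        Or.inr ⟨hze, fun h => hzn (Or.inr h)⟩,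
        ht.union (D.pos y) hty hyq (D.arc_isSimpleArc q y hqy).isPreconnected_diff_left⟩
    · obtain ⟨t, htC, htx, htu, ht⟩ := hpath u hu
      exact ⟨t ∪ D.arc ⟨s(u, w), he⟩, union_subset htC (harcX he hu hw), Or.inl htx, Or.inr hze,
        ht.union (D.pos u) htu (D.pos_mem_arc he).1
          (D.arc_isSimpleArc u w he).isPreconnected⟩

/-- A connected set that avoids all arcs and touches all vertices excludes a `K₂,₃` minor. -/
theorem not_isTheta [Finite V] {F : Set Plane} (hF : IsPreconnected F)
    (hFarc : ∀ e, Disjoint F (D.arc e)) (hFcl : ∀ v, D.pos v ∈ closure F) {p q : V}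
    {X Y Z : Set V} : ¬ G.IsTheta {p} {q} X Y Z := by
  intro h
  let W : Fin 3 → Set V := ![X, Y, Z]
  have hc : ∀ i, G.ConnOn (W i) := by
    intro i; fin_cases i; exacts [h.cX, h.cY, h.cZ]
  have hp : ∀ i, G.Touches {p} (W i) := by
    intro i; fin_cases i; exacts [h.tAX, h.tAY, h.tAZ]
  have hq : ∀ i, G.Touches {q} (W i) := by
    intro i; fin_cases i; exacts [h.tBX, h.tBY, h.tBZ]
  have hpW : ∀ i, p ∉ W i := by
    intro i; rw [← disjoint_singleton_left]; fin_cases i; exacts [h.dAX, h.dAY, h.dAZ]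
  have hqW : ∀ i, q ∉ W i := by
    intro i; rw [← disjoint_singleton_left]; fin_cases i; exacts [h.dBX, h.dBY, h.dBZ]
  have hW : ∀ i j, i ≠ j → Disjoint (W i) (W j) := by
    intro i j hij
    fin_cases i <;> fin_cases j
    exacts [(hij rfl).elim, h.dXY, h.dXZ, h.dXY.symm, (hij rfl).elim, h.dYZ, h.dXZ.symm,
      h.dYZ.symm, (hij rfl).elim]
  have hpq : p ≠ q := by simpa using h.dAB
  choose p' hp' x hx hpx using hp
  choose q' hq' y hy hqy using hq
  simp only [mem_singleton_iff] at hp' hq'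
  obtain rfl : p' = fun _ => p := funext hp'
  obtain rfl : q' = fun _ => q := funext hq'
  have hl := fun i => D.linkEdges_connected (hc i) (hx i) (hy i) (hpW i) (hqW i) hpq (hpx i) (hqy i)
  refine D.no_theta_edges hpq (fun i => G.linkEdges p q (x i) (y i) (W i)) W
    (fun i e he v hv => SimpleGraph.mem_or_of_mem_linkEdges (hx i) (hy i) he hv) hW hpW hqW
    (fun i j hij => ?_) (fun i => (hl i).1) (fun i => (hl i).2.1) hF (fun i => ?_) (fun i => ?_)
  · rw [disjoint_left]
    intro e hei hej
    obtain ⟨v, hv, hvW⟩ := SimpleGraph.exists_mem_of_mem_linkEdges (hx i) (hy i) hei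
    rcases SimpleGraph.mem_or_of_mem_linkEdges (hx j) (hy j) hej hv with h' | rfl | rfl
    · exact disjoint_left.mp (hW i j hij) hvW h'
    · exact hpW i hvW
    · exact hqW i hvW
  · exact disjoint_iUnion₂_right.mpr fun e _ => hFarc e
  · exact ⟨D.pos (x i), hFcl _, (hl i).2.2 _ (hx i)⟩

/-- A connected set that avoids the arcs of a complete graph on `a`, `b`, `c`, `d` and touches `c`
and `d` does not touch the interior of the arc of `ab`. -/
theorem not_touches_arc [Finite V] {F : Set Plane} (hF : IsPreconnected F) {a b c d : V}
    (hab : G.Adj a b) (hac : G.Adj a c) (had : G.Adj a d) (hbc : G.Adj b c) (hbd : G.Adj b d)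
    (hcd : c ≠ d)
    (hFarc : ∀ e : G.edgeSet, (∀ v ∈ (e : Sym2 V), v = a ∨ v = b ∨ v = c ∨ v = d) →
      Disjoint F (D.arc e)) (hc : D.pos c ∈ closure F) (hd : D.pos d ∈ closure F) :
    closure F ∩ D.arc ⟨s(a, b), hab⟩ ⊆ {D.pos a, D.pos b} := by
  intro z hz
  by_contra hzn
  let W : Fin 3 → Set V := ![∅, {c}, {d}]
  let E : Fin 3 → Set G.edgeSet :=
    ![{⟨s(a, b), hab⟩}, G.linkEdges a b c c {c}, G.linkEdges a b d d {d}]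
  have lc := D.linkEdges_connected (SimpleGraph.connOn_singleton c) rfl rfl
    (by simpa using hac.ne) (by simpa using hbc.ne) hab.ne hac hbc
  have ld := D.linkEdges_connected (SimpleGraph.connOn_singleton d) rfl rfl
    (by simpa using had.ne) (by simpa using hbd.ne) hab.ne had hbd
  have h0 : D.arcs (E 0) = D.arc ⟨s(a, b), hab⟩ := by simp [E, arcs]
  have hE : ∀ i, ∀ e ∈ E i, ∀ v ∈ (e : Sym2 V), v ∈ W i ∨ v = a ∨ v = b := by
    intro i
    fin_cases i
    · rintro e rfl v hv
      exact Or.inr (Sym2.mem_iff.mp hv)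
    · exact fun e he v hv => SimpleGraph.mem_or_of_mem_linkEdges (X := {c}) rfl rfl he hv
    · exact fun e he v hv => SimpleGraph.mem_or_of_mem_linkEdges (X := {d}) rfl rfl he hv
  have hex : ∀ i, i ≠ 0 → ∀ e ∈ E i, ∃ v ∈ (e : Sym2 V), v ∈ W i := by
    intro i
    fin_cases i
    · exact fun h => (h rfl).elim
    · exact fun _ e he => SimpleGraph.exists_mem_of_mem_linkEdges (X := {c}) rfl rfl he
    · exact fun _ e he => SimpleGraph.exists_mem_of_mem_linkEdges (X := {d}) rfl rfl he
  have hW : ∀ i j, i ≠ j → Disjoint (W i) (W j) := by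
    intro i j hij
    have hcd' : Disjoint {c} {d} := disjoint_singleton.mpr hcd
    fin_cases i <;> fin_cases j
    exacts [(hij rfl).elim, empty_disjoint _, empty_disjoint _, disjoint_empty _, (hij rfl).elim,
      hcd', disjoint_empty _, hcd'.symm, (hij rfl).elim]
  have haW : ∀ i, a ∉ W i := by
    intro i; fin_cases i <;> simp [W, hac.ne, had.ne]
  have hbW : ∀ i, b ∉ W i := by
    intro i; fin_cases i <;> simp [W, hbc.ne, hbd.ne]
  have hEd' : ∀ i j, i ≠ j → i ≠ 0 → Disjoint (E i) (E j) := by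
    intro i j hij hi
    rw [disjoint_left]
    intro e hei hej
    obtain ⟨v, hv, hvW⟩ := hex i hi e hei
    rcases hE j e hej v hv with h' | rfl | rfl
    · exact disjoint_left.mp (hW i j hij) hvW h'
    · exact haW i hvW
    · exact hbW i hvW
  refine D.no_theta_edges hab.ne E W hE hW haW hbW (fun i j hij => ?_) (fun i => ?_) (fun i => ?_)
    hF (fun i => ?_) (fun i => ?_)
  · by_cases hi : i = 0
    · exact (hEd' j i hij.symm (fun hj => hij (hi.trans hj.symm))).symm
    · exact hEd' i j hij hi
  · fin_cases i
    · simp only [Fin.zero_eta, h0]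
      exact (D.arc_isSimpleArc a b hab).joinedIn.symm
    · exact lc.1
    · exact ld.1
  · fin_cases i
    · simp only [Fin.zero_eta, h0]
      exact (D.arc_isSimpleArc a b hab).isPreconnected_diff_pair
    · exact lc.2.1
    · exact ld.2.1
  · refine disjoint_iUnion₂_right.mpr fun e he => hFarc e fun v hv => ?_
    have := hE i e he v hv
    fin_cases i <;> simp [W] at this <;> tauto
  · fin_cases i
    · simp only [Fin.zero_eta, h0]
      exact ⟨z, hz.1, hz.2, hzn⟩
    · exact ⟨_, hc, lc.2.2 c rfl⟩
    · exact ⟨_, hd, ld.2.2 d rfl⟩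

/-- A connected set that avoids all arcs and touches all vertices excludes a complete subgraph on
four vertices: the component `F'` of the complement of the drawing of that subgraph that contains
the set is bounded by more than the four vertices, hence touches the interior of an arc. -/
theorem not_isNClique_four [Finite V] {F : Set Plane} (hF : IsPreconnected F)
    (hFarc : ∀ e, Disjoint F (D.arc e)) (hFcl : ∀ v, D.pos v ∈ closure F) {s : Finset V} :
    ¬ G.IsNClique 4 s := by
  classical
  intro hs
  let E : Set G.edgeSet := {e | ∀ v ∈ (e : Sym2 V), v ∈ s}
  obtain ⟨a, ha, b, hb, hab⟩ := Finset.one_lt_card.mp (show 1 < s.card by rw [hs.card_eq]; norm_num)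
  have hadj : ∀ {u v}, u ∈ s → v ∈ s → u ≠ v → G.Adj u v := fun hu hv h => hs.isClique hu hv h
  obtain ⟨f, hf⟩ : F.Nonempty := closure_nonempty_iff.mp ⟨_, hFcl a⟩
  have hFE : F ⊆ (D.arcs E)ᶜ := fun x hx h => by
    simp only [arcs, mem_iUnion, exists_prop] at h
    obtain ⟨e, -, he⟩ := h
    exact disjoint_left.mp (hFarc e) hx he
  obtain ⟨F', hF'⟩ : ∃ F', F' = connectedComponentIn (D.arcs E)ᶜ f := ⟨_, rfl⟩
  have hFF' : F ⊆ F' := hF' ▸ hF.subset_connectedComponentIn hf hFE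
  have hF'pre : IsPreconnected F' := hF' ▸ isPreconnected_connectedComponentIn
  have hF'E : F' ⊆ (D.arcs E)ᶜ := hF' ▸ connectedComponentIn_subset _ _
  have hEcl := D.isClosed_arcs E
  have hF'o : IsOpen F' := hF' ▸ hEcl.isOpen_compl.connectedComponentIn
  have hcl : ∀ v, D.pos v ∈ closure F' := fun v => closure_mono hFF' (hFcl v)
  let S : Set Plane := D.pos '' s
  have hSfin : S.Finite := s.finite_toSet.image _
  have hSE : S ⊆ D.arcs E := by
    rintro _ ⟨v, hv, rfl⟩
    obtain ⟨w, hw, hwv⟩ := Finset.exists_mem_ne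
      (show 1 < s.card by rw [hs.card_eq]; norm_num) v
    refine D.arc_subset_arcs (e := ⟨s(v, w), hadj hv hw hwv.symm⟩) ?_ (D.pos_mem_arc _).1
    intro x hx
    rcases Sym2.mem_iff.mp hx with rfl | rfl
    exacts [hv, hw]
  -- some point of the drawing other than the four vertices is in the closure of `F'`
  obtain ⟨z, hzcl, hzE, hzS⟩ : ∃ z ∈ closure F', z ∈ D.arcs E ∧ z ∉ S := by
    by_contra hcon
    push Not at hcon
    have hclF' : closure F' ∩ Sᶜ ⊆ F' := by
      rintro z ⟨hz, hzS⟩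
      have hzE : z ∉ D.arcs E := fun h => hzS (hcon z hz h)
      have hpre : IsPreconnected (insert z F') :=
        hF'pre.subset_closure (subset_insert _ _) (insert_subset hz subset_closure)
      rw [hF']
      exact hpre.subset_connectedComponentIn (mem_insert_of_mem _ (hFF' hf))
        (insert_subset hzE hF'E) (mem_insert _ _)
    have hrank : 1 < Module.rank ℝ Plane := by
      rw [← Module.finrank_eq_rank, finrank_euclideanSpace]
      norm_num
    have hSpre : IsPreconnected Sᶜ :=
      (hSfin.countable.isPathConnected_compl_of_one_lt_rank hrank).isConnected.isPreconnected
    have hall : Sᶜ ⊆ F' := by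
      refine (hSpre.subset_left_of_subset_union hF'o isClosed_closure.isOpen_compl
        (disjoint_left.mpr fun x hx h => h (subset_closure hx)) (fun x hx => ?_)
        ⟨f, fun h => hF'E (hFF' hf) (hSE h), hFF' hf⟩)
      by_cases h : x ∈ closure F'
      · exact Or.inl (hclF' ⟨h, hx⟩)
      · exact Or.inr h
    have hinf := (D.arc_isSimpleArc a b (hadj ha hb hab)).infinite
    obtain ⟨x, hx, hxS⟩ := hinf.exists_notMem_finite hSfin
    refine hF'E (hall hxS) (D.arc_subset_arcs ?_ hx)
    intro v hv
    rcases Sym2.mem_iff.mp hv with rfl | rfl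
    exacts [ha, hb]
  simp only [arcs, mem_iUnion, exists_prop] at hzE
  obtain ⟨⟨e, he⟩, heE, hze⟩ := hzE
  induction e using Sym2.ind with
  | _ u v =>
    have huv : G.Adj u v := he
    have hu : u ∈ s := heE u (by simp)
    have hv : v ∈ s := heE v (by simp)
    have hcard : (s \ {u, v}).card = 2 := by
      rw [Finset.card_sdiff_of_subset (by
        intro x hx
        rcases Finset.mem_insert.mp hx with rfl | hx
        · exact hu
        · exact Finset.mem_singleton.mp hx ▸ hv), hs.card_eq, Finset.card_pair huv.ne]
    obtain ⟨c, d, hcd, hsd⟩ := Finset.card_eq_two.mp hcard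
    have hc : c ∈ s \ {u, v} := by rw [hsd]; simp
    have hd : d ∈ s \ {u, v} := by rw [hsd]; simp
    simp only [Finset.mem_sdiff, Finset.mem_insert, Finset.mem_singleton, not_or] at hc hd
    have := D.not_touches_arc hF'pre huv (hadj hu hc.1 (Ne.symm hc.2.1))
      (hadj hu hd.1 (Ne.symm hd.2.1)) (hadj hv hc.1 (Ne.symm hc.2.2))
      (hadj hv hd.1 (Ne.symm hd.2.2)) hcd (fun e he' => ?_) (hcl c) (hcl d) ⟨hzcl, hze⟩
    · rcases this with rfl | h
      · exact hzS ⟨u, hu, rfl⟩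
      · exact hzS ⟨v, hv, h.symm⟩
    · refine disjoint_left.mpr fun x hx hxe => hF'E hx (D.arc_subset_arcs (fun w hw => ?_) hxe)
      rcases he' w hw with rfl | rfl | rfl | rfl
      exacts [hu, hv, hc.1, hd.1]

end PlaneEmbedding

/-- An outerplanar graph has a noncrossing arrangement. -/
theorem IsOuterplanar.exists_arrangement {V : Type*} [Finite V] {G : SimpleGraph V}
    (h : IsOuterplanar G) : ∃ l, G.IsArrangement univ l := by
  classical
  obtain ⟨D, F, ⟨x, hx, rfl⟩, hv⟩ := h
  have hpre : IsPreconnected (connectedComponentIn D.carrierᶜ x) :=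
    isPreconnected_connectedComponentIn
  have harc : ∀ e, Disjoint (connectedComponentIn D.carrierᶜ x) (D.arc e) := fun e =>
    disjoint_left.mpr fun z hz hze => connectedComponentIn_subset _ _ hz
      (Or.inr (mem_iUnion.mpr ⟨e, hze⟩))
  have hcl := fun v => frontier_subset_closure (hv v)
  refine SimpleGraph.exists_arrangement (fun A B X Y Z h => ?_) (fun a b c d h => ?_)
  · obtain ⟨a, b, X', Y', Z', h'⟩ := h.exists_singletons
    exact D.not_isTheta hpre harc hcl h'
  · refine D.not_isNClique_four hpre harc hcl (s := {a, b, c, d}) ?_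
    have hab := SimpleGraph.touches_singleton.mp h.tAB
    have hac := SimpleGraph.touches_singleton.mp h.tAC
    have had := SimpleGraph.touches_singleton.mp h.tAD
    have hbc := SimpleGraph.touches_singleton.mp h.tBC
    have hbd := SimpleGraph.touches_singleton.mp h.tBD
    have hcd := SimpleGraph.touches_singleton.mp h.tCD
    refine ⟨?_, by simp [hab.ne, hac.ne, had.ne, hbc.ne, hbd.ne, hcd.ne]⟩
    simp [SimpleGraph.isClique_iff, Set.pairwise_insert, hab, hac, had, hbc, hbd, hcd, hab.symm,
      hac.symm, had.symm, hbc.symm, hbd.symm, hcd.symm]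

end

/-! ### Noncrossing graphs are outerplanar -/

section

open Set Topology

namespace SimpleGraph

variable {V : Type*}

/-- No two edges of `G` cross when each vertex `v` is placed at the point `t v` of a line and the
edges are drawn on one side of it. -/
def NoncrossingAt (G : SimpleGraph V) (t : V → ℕ) : Prop :=
  ∀ w x y z, t w < t x → t x < t y → t y < t z → G.Adj w y → ¬ G.Adj x z

/-- The point of the parabola above `a`. -/
noncomputable def parabola (a : ℝ) : Plane := !₂[a, a ^ 2]

theorem parabola_injective : Function.Injective parabola := fun a b h => by
  simpa [parabola] using congrArg (fun p : Plane => p 0) h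

theorem mem_segment_parabola {a b : ℝ} {z : Plane} (hz : z ∈ segment ℝ (parabola a) (parabola b)) :
    z 1 = (a + b) * z 0 - a * b ∧ 0 ≤ (z 0 - a) * (b - z 0) := by
  obtain ⟨c, d, hc, hd, hcd, rfl⟩ := hz
  obtain rfl : c = 1 - d := by linarith
  simp only [parabola, PiLp.add_apply, PiLp.smul_apply, smul_eq_mul,
    Matrix.cons_val_zero, Matrix.cons_val_one]
  refine ⟨by ring, ?_⟩
  have : ((1 - d) * a + d * b - a) * (b - ((1 - d) * a + d * b)) = (1 - d) * d * (b - a) ^ 2 := by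
    ring
  rw [this]
  positivity

theorem eq_parabola_of_mem_segment {a b : ℝ} {z : Plane}
    (hz : z ∈ segment ℝ (parabola a) (parabola b)) (h : (z 0 - a) * (b - z 0) = 0) :
    z = parabola a ∨ z = parabola b := by
  have h1 := (mem_segment_parabola hz).1
  rcases mul_eq_zero.mp h with h | h
  · left
    have h0 : z 0 = a := by linarith
    ext i
    fin_cases i
    · simpa [parabola] using h0
    · simp only [parabola, Fin.mk_one, PiLp.toLp_apply, Matrix.cons_val_one,
        Matrix.cons_val_fin_one]
      rw [h1, h0]; ring
  · right
    have h0 : z 0 = b := by linarith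
    ext i
    fin_cases i
    · simpa [parabola] using h0
    · simp only [parabola, Fin.mk_one, PiLp.toLp_apply, Matrix.cons_val_one,
        Matrix.cons_val_fin_one]
      rw [h1, h0]; ring

theorem isSimpleArc_segment {p q : Plane} (h : p ≠ q) : IsSimpleArc (segment ℝ p q) p q := by
  let γ : _root_.Path p q :=
    { toFun := fun s => AffineMap.lineMap p q (s : ℝ)
      continuous_toFun := by
        simp only [AffineMap.lineMap_apply_module]
        fun_prop
      source' := by simp
      target' := by simp }
  refine ⟨γ, fun s s' hs => ?_, ?_⟩
  · exact Subtype.ext (AffineMap.lineMap_injective ℝ h hs)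
  · rw [segment_eq_image_lineMap]
    ext x
    constructor
    · rintro ⟨s, rfl⟩
      exact ⟨s, s.2, rfl⟩
    · rintro ⟨s, hs, rfl⟩
      exact ⟨⟨s, hs⟩, rfl⟩

/-- Two chords of the parabola that do not cross meet at most in an end point of the first one. -/
theorem segment_parabola_inter {a b c d : ℝ} (hab : a < b) (hcd : c < d)
    (hne : ¬ (a = c ∧ b = d)) (h₁ : ¬ (a < c ∧ c < b ∧ b < d)) (h₂ : ¬ (c < a ∧ a < d ∧ d < b))
    {z : Plane} (hz : z ∈ segment ℝ (parabola a) (parabola b))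
    (hz' : z ∈ segment ℝ (parabola c) (parabola d)) : z = parabola a ∨ z = parabola b := by
  apply eq_parabola_of_mem_segment hz
  obtain ⟨e1, p1⟩ := mem_segment_parabola hz
  obtain ⟨e2, p2⟩ := mem_segment_parabola hz'
  generalize z 0 = X at *
  -- both products are the height of `z` above the parabola
  have he : (X - a) * (b - X) = (X - c) * (d - X) := by linarith
  by_contra hn
  have p1' : 0 < (X - a) * (b - X) := lt_of_le_of_ne p1 (Ne.symm hn)
  have p2' : 0 < (X - c) * (d - X) := he ▸ p1'
  have haX : 0 < X - a ∧ 0 < b - X := by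
    rcases pos_and_pos_or_neg_and_neg_of_mul_pos p1' with h | h
    · exact h
    · linarith [h.1, h.2]
  have hcX : 0 < X - c ∧ 0 < d - X := by
    rcases pos_and_pos_or_neg_and_neg_of_mul_pos p2' with h | h
    · exact h
    · linarith [h.1, h.2]
  rcases lt_trichotomy a c with h | rfl | h
  · have hdb : d ≤ b := by
      by_contra hc
      exact h₁ ⟨h, by linarith, by linarith⟩
    nlinarith [mul_pos (sub_pos.mpr h) haX.2, mul_nonneg hcX.1.le (sub_nonneg.mpr hdb)]
  · exact hne ⟨rfl, by linarith [mul_left_cancel₀ haX.1.ne' he]⟩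
  · have hdb : b ≤ d := by
      by_contra hc
      exact h₂ ⟨h, by linarith, by linarith⟩
    nlinarith [mul_pos (sub_pos.mpr h) hcX.2, mul_nonneg haX.1.le (sub_nonneg.mpr hdb)]

theorem convexHull_image_sym2 (g : V → Plane) (u v : V) :
    convexHull ℝ (g '' {w | w ∈ s(u, v)}) = segment ℝ (g u) (g v) := by
  have : {w | w ∈ s(u, v)} = ({u, v} : Set V) := by ext; simp
  rw [this, image_pair, convexHull_pair]

/-- The drawing of a noncrossing graph whose vertices lie on a parabola and whose edges are
chords. -/
noncomputable def NoncrossingAt.embedding {G : SimpleGraph V} {t : V → ℕ}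
    (h : G.NoncrossingAt t) (ht : Function.Injective t) : PlaneEmbedding G where
  pos v := parabola (t v)
  arc e := convexHull ℝ ((fun v => parabola (t v)) '' {w | w ∈ (e : Sym2 V)})
  pos_injective := parabola_injective.comp (Nat.cast_injective.comp ht)
  arc_isSimpleArc u v huv := by
    rw [convexHull_image_sym2]
    exact isSimpleArc_segment fun he => huv.ne (ht (Nat.cast_injective (parabola_injective he)))
  mem_of_pos_mem_arc v e he := by
    obtain ⟨e, hadj⟩ := e
    induction e using Sym2.ind with
    | _ a b =>
      rw [convexHull_image_sym2] at he
      obtain ⟨h1, -⟩ := mem_segment_parabola he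
      have : parabola (t v) = parabola (t a) ∨ parabola (t v) = parabola (t b) := by
        apply eq_parabola_of_mem_segment he
        simp only [parabola, PiLp.toLp_apply, Matrix.cons_val_zero, Matrix.cons_val_one,
          Matrix.cons_val_fin_one] at h1 ⊢
        linear_combination -h1
      rcases this with h | h
      · simp [ht (Nat.cast_injective (parabola_injective h))]
      · simp [ht (Nat.cast_injective (parabola_injective h))]
  arc_inter_arc := by
    have key : ∀ u v w x, G.Adj u v → G.Adj w x → s(u, v) ≠ s(w, x) → t u < t v → t w < t x →
        segment ℝ (parabola (t u)) (parabola (t v)) ∩ segment ℝ (parabola (t w)) (parabola (t x)) ⊆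
          range fun v => parabola (t v) := by
      rintro u v w x huv hwx hne h1 h2 z ⟨hz, hz'⟩
      suffices h : z = parabola (t u) ∨ z = parabola (t v) by
        rcases h with rfl | rfl
        exacts [⟨u, rfl⟩, ⟨v, rfl⟩]
      refine segment_parabola_inter (Nat.cast_lt.mpr h1) (Nat.cast_lt.mpr h2) ?_ ?_ ?_ hz hz'
      · rintro ⟨e1, e2⟩
        exact hne (by rw [ht (Nat.cast_injective e1), ht (Nat.cast_injective e2)])
      · rintro ⟨l1, l2, l3⟩
        exact h u w v x (Nat.cast_lt.mp l1) (Nat.cast_lt.mp l2) (Nat.cast_lt.mp l3) huv hwx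
      · rintro ⟨l1, l2, l3⟩
        exact h w u x v (Nat.cast_lt.mp l1) (Nat.cast_lt.mp l2) (Nat.cast_lt.mp l3) hwx huv
    have sorted : ∀ e : Sym2 V, e ∈ G.edgeSet → ∃ u v, e = s(u, v) ∧ G.Adj u v ∧ t u < t v := by
      intro e he
      induction e using Sym2.ind with
      | _ u v =>
        have he : G.Adj u v := he
        rcases lt_or_gt_of_ne (ht.ne he.ne) with h | h
        · exact ⟨u, v, rfl, he, h⟩
        · exact ⟨v, u, Sym2.eq_swap, he.symm, h⟩
    rintro ⟨e, he⟩ ⟨f, hf⟩ hef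
    obtain ⟨u, v, rfl, huv, h1⟩ := sorted e he
    obtain ⟨w, x, rfl, hwx, h2⟩ := sorted f hf
    rw [convexHull_image_sym2, convexHull_image_sym2]
    exact key u v w x huv hwx (fun h => hef (Subtype.ext h)) h1 h2

/-- A noncrossing graph is outerplanar: the region below the parabola lies in one face. -/
theorem NoncrossingAt.isOuterplanar {G : SimpleGraph V} {t : V → ℕ}
    (h : G.NoncrossingAt t) (ht : Function.Injective t) : IsOuterplanar G := by
  let B : Set Plane := {z | z 1 < z 0 ^ 2}
  have hBD : B ⊆ ((h.embedding ht).carrier)ᶜ := by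
    rintro z hz (⟨v, rfl⟩ | hz')
    · simp [B, embedding, parabola] at hz
    · obtain ⟨⟨e, he⟩, hz'⟩ := mem_iUnion.mp hz'
      induction e using Sym2.ind with
      | _ u v =>
        change z ∈ convexHull ℝ _ at hz'
        rw [convexHull_image_sym2] at hz'
        obtain ⟨h1, h2⟩ := mem_segment_parabola hz'
        have hz : z 1 < z 0 ^ 2 := hz
        nlinarith
  have hBpre : IsPreconnected B := by
    have : B = (fun p : ℝ × ℝ => (!₂[p.1, p.1 ^ 2 - p.2] : Plane)) '' (univ ×ˢ Ioi 0) := by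
      ext z
      constructor
      · intro hz
        refine ⟨(z 0, z 0 ^ 2 - z 1), ⟨mem_univ _, mem_Ioi.mpr (sub_pos.mpr hz)⟩, ?_⟩
        ext i
        fin_cases i <;> simp
      · rintro ⟨⟨x, s⟩, ⟨-, hs⟩, rfl⟩
        have hs : 0 < s := hs
        simpa [B] using hs
    rw [this]
    refine (isPreconnected_univ.prod isPreconnected_Ioi).image _ (Continuous.continuousOn ?_)
    fun_prop
  have h0B : (!₂[0, -1] : Plane) ∈ B := by simp [B]
  refine ⟨h.embedding ht, _, ⟨!₂[0, -1], hBD h0B, rfl⟩, fun v => ?_⟩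
  have hBF := hBpre.subset_connectedComponentIn h0B hBD
  refine ⟨closure_mono hBF ?_, fun hint => ?_⟩
  · -- the vertex is approached from below
    have hc : Continuous fun s : ℝ => (!₂[(t v : ℝ), (t v : ℝ) ^ 2 - s] : Plane) := by fun_prop
    have hlim : Filter.Tendsto (fun s : ℝ => (!₂[(t v : ℝ), (t v : ℝ) ^ 2 - s] : Plane)) (𝓝[>] 0)
        (𝓝 (parabola (t v))) := by
      have := (hc.tendsto 0).mono_left (nhdsWithin_le_nhds (s := Ioi 0))
      simpa [parabola] using this
    refine mem_closure_of_tendsto hlim ?_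
    filter_upwards [self_mem_nhdsWithin] with s hs
    have hs : 0 < s := hs
    simpa [B] using hs
  · exact connectedComponentIn_subset _ _ (interior_subset hint) (Or.inl ⟨v, rfl⟩)

theorem IsArrangement.exists_noncrossingAt {G : SimpleGraph V} {l : List V}
    (h : G.IsArrangement univ l) : ∃ f : V ≃ Fin l.length, G.NoncrossingAt fun v => f v := by
  classical
  let f := (h.nodup.getEquivOfForallMemList l fun x => (h.mem_iff x).mpr (mem_univ x)).symm
  have hf : ∀ v, l[f v] = v := fun v => f.symm_apply_apply v
  refine ⟨f, fun w x y z h1 h2 h3 => h.nc w x y z ?_⟩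
  have := List.map_getElem_sublist (l := l) (is := [f w, f x, f y, f z]) (by
    simp only [List.pairwise_cons, List.mem_cons, List.not_mem_nil, or_false, forall_eq_or_imp,
      forall_eq, false_imp_iff, implies_true, List.Pairwise.nil, and_true, Fin.lt_def]
    exact ⟨⟨h1, h1.trans h2, (h1.trans h2).trans h3⟩, ⟨h2, h2.trans h3⟩, h3⟩)
  simpa only [List.map_cons, List.map_nil, hf] using this

end SimpleGraph

theorem IsOuterplanar.exists_noncrossingAt {n : ℕ} {G : SimpleGraph (Fin n)}
    (h : IsOuterplanar G) : ∃ f : Fin n ≃ Fin n, G.NoncrossingAt fun v => f v := by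
  obtain ⟨l, hl⟩ := h.exists_arrangement
  obtain ⟨f, hf⟩ := hl.exists_noncrossingAt
  have hn : l.length = n := by simpa using (Fintype.card_congr f).symm
  clear hl
  generalize l.length = k at f hn
  subst hn
  exact ⟨f, hf⟩

end

/-! ### The number of edges -/

/-- The number of pairs `a ≤ x < y ≤ b` that are related by `r`. -/
noncomputable def pairCount (r : ℕ → ℕ → Prop) (a b : ℕ) : ℕ :=
  {p : ℕ × ℕ | a ≤ p.1 ∧ p.1 < p.2 ∧ p.2 ≤ b ∧ r p.1 p.2}.ncard

theorem finite_pairs (r : ℕ → ℕ → Prop) (a b : ℕ) :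
    {p : ℕ × ℕ | a ≤ p.1 ∧ p.1 < p.2 ∧ p.2 ≤ b ∧ r p.1 p.2}.Finite := by
  refine ((Set.finite_Iic b).prod (Set.finite_Iic b)).subset ?_
  rintro ⟨x, y⟩ ⟨-, h1, h2, -⟩
  exact ⟨(h1.le.trans h2), h2⟩

/-- In a noncrossing relation to which no pair can be added, a related pair `a < b` bounds an
interval with `2 (b - a) - 1` related pairs: if `k` is the last partner of `a` before `b`, then
`k` is related to `b`, and the pairs are `(a, b)` and those in `[a, k]` and `[k, b]`. -/
theorem pairCount_of_maximal {r : ℕ → ℕ → Prop} {n : ℕ}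
    (hnc : ∀ i j k m, i < j → j < k → k < m → r i k → ¬ r j m)
    (hmax : ∀ i j, i < j → j < n → ¬ r i j →
      ∃ k m, r k m ∧ ((k < i ∧ i < m ∧ m < j) ∨ (i < k ∧ k < j ∧ j < m)))
    {a b : ℕ} (hab : a < b) (hb : b < n) (hr : r a b) : pairCount r a b + 1 = 2 * (b - a) := by
  classical
  induction hd : b - a using Nat.strong_induction_on generalizing a b with
  | _ d ih =>
    have hsucc : ∀ i, i + 1 < n → r i (i + 1) := by
      intro i hi
      by_contra hcon
      obtain ⟨k, m, -, h⟩ := hmax i (i + 1) (Nat.lt_succ_self i) hi hcon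
      omega
    by_cases hba : b = a + 1
    · subst hba
      have : {p : ℕ × ℕ | a ≤ p.1 ∧ p.1 < p.2 ∧ p.2 ≤ a + 1 ∧ r p.1 p.2} = {(a, a + 1)} := by
        ext ⟨x, y⟩
        simp only [Set.mem_ofPred_eq, Set.mem_singleton_iff, Prod.mk.injEq]
        constructor
        · rintro ⟨h1, h2, h3, -⟩; omega
        · rintro ⟨rfl, rfl⟩; exact ⟨le_rfl, Nat.lt_succ_self _, le_rfl, hr⟩
      rw [pairCount, this, Set.ncard_singleton]
      omega
    obtain ⟨k, ⟨hak, hkb, hrk⟩, hlast⟩ : ∃ k, (a < k ∧ k < b ∧ r a k) ∧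
        ∀ m, a < m ∧ m < b ∧ r a m → m ≤ k := by
      have hne : ((Finset.range b).filter fun m => a < m ∧ r a m).Nonempty :=
        ⟨a + 1, by simp only [Finset.mem_filter, Finset.mem_range]
                   exact ⟨by omega, by omega, hsucc a (by omega)⟩⟩
      refine ⟨Finset.max' _ hne, ?_, fun m hm => Finset.le_max' _ m ?_⟩
      · have := Finset.max'_mem _ hne
        simp only [Finset.mem_filter, Finset.mem_range] at this
        exact ⟨this.2.1, this.1, this.2.2⟩
      · simp only [Finset.mem_filter, Finset.mem_range]
        exact ⟨hm.2.1, hm.1, hm.2.2⟩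
    have hrkb : r k b := by
      by_contra hcon
      obtain ⟨p, q, hpq, ⟨h1, h2, h3⟩ | ⟨h1, h2, h3⟩⟩ := hmax k b hkb hb hcon
      · rcases lt_trichotomy p a with h | rfl | h
        · exact hnc p a q b h (by omega) h3 hpq hr
        · have := hlast q ⟨by omega, h3, hpq⟩
          omega
        · exact hnc a p k q h h1 h2 hrk hpq
      · exact hnc a p b q (by omega) h2 h3 hr hpq
    have hset : {p : ℕ × ℕ | a ≤ p.1 ∧ p.1 < p.2 ∧ p.2 ≤ b ∧ r p.1 p.2} =
        insert (a, b) ({p : ℕ × ℕ | a ≤ p.1 ∧ p.1 < p.2 ∧ p.2 ≤ k ∧ r p.1 p.2} ∪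
          {p : ℕ × ℕ | k ≤ p.1 ∧ p.1 < p.2 ∧ p.2 ≤ b ∧ r p.1 p.2}) := by
      ext ⟨x, y⟩
      simp only [Set.mem_ofPred_eq, Set.mem_insert_iff, Set.mem_union, Prod.mk.injEq]
      constructor
      · rintro ⟨h1, h2, h3, h4⟩
        by_cases hy : y ≤ k
        · exact Or.inr (Or.inl ⟨h1, h2, hy, h4⟩)
        by_cases hx : k ≤ x
        · exact Or.inr (Or.inr ⟨hx, h2, h3, h4⟩)
        left
        rcases h1.eq_or_lt with rfl | h1
        · refine ⟨rfl, ?_⟩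
          by_contra hyb
          have := hlast y ⟨h2, by omega, h4⟩
          omega
        · exact absurd h4 (hnc a x k y h1 (by omega) (by omega) hrk)
      · rintro (⟨rfl, rfl⟩ | ⟨h1, h2, h3, h4⟩ | ⟨h1, h2, h3, h4⟩)
        · exact ⟨le_rfl, hab, le_rfl, hr⟩
        · exact ⟨h1, h2, by omega, h4⟩
        · exact ⟨by omega, h2, h3, h4⟩
    have h1 := ih (k - a) (by omega) hak (by omega) hrk rfl
    have h2 := ih (b - k) (by omega) hkb hb hrkb rfl
    have hfin := (finite_pairs r a k).union (finite_pairs r k b)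
    rw [pairCount] at h1 h2 ⊢
    rw [hset, Set.ncard_insert_of_notMem _ hfin, Set.ncard_union_eq _ (finite_pairs r a k)
      (finite_pairs r k b)]
    · omega
    · rw [Set.disjoint_left]
      rintro ⟨x, y⟩ ⟨-, h1, h2, -⟩ ⟨h3, -⟩
      simp only at *
      omega
    · rintro (⟨-, -, h, -⟩ | ⟨h, -⟩) <;> simp only at h <;> omega

namespace SimpleGraph

variable {V : Type*} {n : ℕ}

theorem ncard_edgeSet_eq_pairCount (G : SimpleGraph V) (f : V ≃ Fin n) :
    G.edgeSet.ncard = pairCount (fun i j => ∃ u v, (f u : ℕ) = i ∧ (f v : ℕ) = j ∧ G.Adj u v)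
      0 (n - 1) := by
  have hinj : ∀ {u v : V}, (f u : ℕ) = f v → u = v := fun h => f.injective (Fin.ext h)
  let g : V → ℕ := fun v => f v
  have hg : Function.Injective g := fun u v h => hinj h
  refine Set.ncard_congr (fun e _ => ((e.map g).inf, (e.map g).sup)) ?_ ?_ ?_
  · intro e he
    induction e using Sym2.ind with
    | _ u v =>
      have he : G.Adj u v := he
      simp only [Sym2.map_mk, Sym2.inf_mk, Sym2.sup_mk, Set.mem_ofPred_eq, zero_le, true_and]
      have hu : g u < n := (f u).2
      have hv : g v < n := (f v).2
      rcases lt_or_gt_of_ne (hg.ne he.ne) with h | h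
      · rw [inf_eq_left.mpr h.le, sup_eq_right.mpr h.le]
        exact ⟨h, by omega, u, v, rfl, rfl, he⟩
      · rw [inf_eq_right.mpr h.le, sup_eq_left.mpr h.le]
        exact ⟨h, by omega, v, u, rfl, rfl, he.symm⟩
  · intro e e' _ _ h
    rw [Prod.mk.injEq, Sym2.inf_eq_inf_and_sup_eq_sup] at h
    exact Sym2.map.injective hg h
  · rintro ⟨i, j⟩ ⟨-, hij, -, u, v, rfl, rfl, huv⟩
    have hij : g u < g v := hij
    refine ⟨s(u, v), huv, ?_⟩
    simp only [Sym2.map_mk, Sym2.inf_mk, Sym2.sup_mk]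
    rw [inf_eq_left.mpr hij.le, sup_eq_right.mpr hij.le]

/-- A noncrossing graph to which no edge can be added has `2 n - 3` edges. -/
theorem NoncrossingAt.ncard_edgeSet (hn : 2 ≤ n) {G : SimpleGraph V} {f : V ≃ Fin n}
    (h : G.NoncrossingAt fun v => f v)
    (hmax : ∀ u v, u ≠ v → ¬ G.Adj u v → ¬ (G ⊔ edge u v).NoncrossingAt fun v => f v) :
    G.edgeSet.ncard + 3 = 2 * n := by
  have hinj : ∀ {u v : V}, (f u : ℕ) = f v → u = v := fun h => f.injective (Fin.ext h)
  rw [ncard_edgeSet_eq_pairCount G f]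
  obtain ⟨r, hr⟩ : ∃ r : ℕ → ℕ → Prop,
      r = fun i j => ∃ u v, (f u : ℕ) = i ∧ (f v : ℕ) = j ∧ G.Adj u v := ⟨_, rfl⟩
  rw [← hr]
  have hnc : ∀ i j k m, i < j → j < k → k < m → r i k → ¬ r j m := by
    subst hr
    rintro _ _ _ _ h1 h2 h3 ⟨w, y, rfl, rfl, hwy⟩ ⟨x, z, rfl, rfl, hxz⟩
    exact h w x y z h1 h2 h3 hwy hxz
  have hm : ∀ i j, i < j → j < n → ¬ r i j →
      ∃ k m, r k m ∧ ((k < i ∧ i < m ∧ m < j) ∨ (i < k ∧ k < j ∧ j < m)) := by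
    intro i j hij hj hrij
    obtain ⟨u, hu⟩ := f.surjective ⟨i, hij.trans hj⟩
    obtain ⟨v, hv⟩ := f.surjective ⟨j, hj⟩
    obtain rfl : (f u : ℕ) = i := by rw [hu]
    obtain rfl : (f v : ℕ) = j := by rw [hv]
    have huv : ¬ G.Adj u v := fun h => hrij (by subst hr; exact ⟨u, v, rfl, rfl, h⟩)
    have hne : u ≠ v := by rintro rfl; exact lt_irrefl _ hij
    have := hmax u v hne huv
    simp only [NoncrossingAt, not_forall, not_not] at this
    obtain ⟨w, x, y, z, h1, h2, h3, hwy, hxz⟩ := this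
    rw [sup_adj, edge_adj] at hwy hxz
    subst hr
    rcases hwy with hwy | ⟨⟨rfl, rfl⟩ | ⟨rfl, rfl⟩, -⟩
    · rcases hxz with hxz | ⟨⟨rfl, rfl⟩ | ⟨rfl, rfl⟩, -⟩
      · exact absurd hxz (h w x y z h1 h2 h3 hwy)
      · exact ⟨_, _, ⟨w, y, rfl, rfl, hwy⟩, Or.inl ⟨h1, h2, h3⟩⟩
      · omega
    · rcases hxz with hxz | ⟨⟨rfl, rfl⟩ | ⟨rfl, rfl⟩, -⟩
      · exact ⟨_, _, ⟨x, z, rfl, rfl, hxz⟩, Or.inr ⟨h1, h2, h3⟩⟩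
      · omega
      · omega
    · omega
  have h0 : r 0 (n - 1) := by
    by_contra hcon
    obtain ⟨k, m, hkm, h | h⟩ := hm 0 (n - 1) (by omega) (by omega) hcon
    · omega
    · subst hr
      obtain ⟨u, v, -, rfl, -⟩ := hkm
      have := (f v).2
      omega
  have := pairCount_of_maximal hnc hm (a := 0) (b := n - 1) (by omega) (by omega) h0
  omega

end SimpleGraph

theorem IsMaximalOuterplanar.ncard_edgeSet {n : ℕ} (hn : 2 ≤ n) {G : SimpleGraph (Fin n)}
    (h : IsMaximalOuterplanar G) : G.edgeSet.ncard + 3 = 2 * n := by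
  obtain ⟨f, hf⟩ := h.1.exists_noncrossingAt
  refine hf.ncard_edgeSet hn fun u v huv hadj hnc => h.2 u v huv hadj ?_
  exact hnc.isOuterplanar (Fin.val_injective.comp f.injective)

theorem IsOuterplanar.ncard_edgeSet_le {n : ℕ} (hn : 2 ≤ n) {G : SimpleGraph (Fin n)}
    (h : IsOuterplanar G) : G.edgeSet.ncard + 3 ≤ 2 * n := by
  obtain ⟨f, hf⟩ := h.exists_noncrossingAt
  obtain ⟨H, hGH, hH⟩ := (Set.toFinite {H : SimpleGraph (Fin n) |
    H.NoncrossingAt fun v => f v}).exists_le_maximal hf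
  have hcard := SimpleGraph.NoncrossingAt.ncard_edgeSet hn hH.prop fun u v huv hadj hnc => by
    have hle : H ⊔ SimpleGraph.edge u v ≤ H := hH.le_of_ge hnc le_sup_left
    exact hadj (hle (Or.inr (by simp [SimpleGraph.edge_adj, huv])))
  rw [← hcard]
  have := Set.ncard_le_ncard (SimpleGraph.edgeSet_mono hGH) (Set.toFinite _)
  omega

/-! ### Maximal outerplanar graphs that need two additional edges -/

/-- The edges `(i, j)`, `i < j`, of a triangulated polygon on the vertices `0, 1, …, 3 m + 1`. It
arises from the edge `01` by repeating a step that adds three vertices: the triangle on the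
edge `(0, 3 s + 1)` with apex `3 s + 3`, and a triangle on each of its other two sides. -/
def stripRel (i j : ℕ) : Prop :=
  i < j ∧ (j = i + 1 ∨ (i = 0 ∧ j % 3 ≠ 2) ∨ (i % 3 = 1 ∧ j = i + 2))

/-- The outer triangle on the edge `(0, 3 s + 3)` in step `s`. -/
def stripTriangleA (s : ℕ) : Multiset (Sym2 ℕ) :=
  {s(0, 3 * s + 3), s(3 * s + 3, 3 * s + 4), s(0, 3 * s + 4)}

/-- The outer triangle on the edge `(3 s + 1, 3 s + 3)` in step `s`. -/
def stripTriangleB (s : ℕ) : Multiset (Sym2 ℕ) :=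
  {s(3 * s + 1, 3 * s + 2), s(3 * s + 2, 3 * s + 3), s(3 * s + 1, 3 * s + 3)}

/-- The edge `01` and the outer triangles of the first `m` steps. -/
def stripEdges (m : ℕ) : Multiset (Sym2 ℕ) :=
  {s(0, 1)} + (∑ s ∈ Finset.range m, stripTriangleA s + ∑ s ∈ Finset.range m, stripTriangleB s)

theorem stripEdges_succ (m : ℕ) :
    stripEdges (m + 1) = stripEdges m + (stripTriangleA m + stripTriangleB m) := by
  simp only [stripEdges, Finset.sum_range_succ]
  abel

theorem mem_stripTriangles {m : ℕ} {e : Sym2 ℕ} :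
    e ∈ stripTriangleA m + stripTriangleB m ↔
      ∃ i j, 3 * m + 2 ≤ j ∧ j < 3 * m + 5 ∧ stripRel i j ∧ e = s(i, j) := by
  simp only [stripTriangleA, stripTriangleB, Multiset.mem_add, Multiset.insert_eq_cons,
    Multiset.mem_cons, Multiset.mem_singleton, stripRel]
  constructor
  · rintro ((rfl | rfl | rfl) | (rfl | rfl | rfl)) <;> refine ⟨_, _, ?_, ?_, ?_, rfl⟩ <;> omega
  · rintro ⟨i, j, h1, h2, ⟨h3, h4⟩, rfl⟩
    have : (i = 0 ∧ j = 3 * m + 3) ∨ (i = 3 * m + 3 ∧ j = 3 * m + 4) ∨ (i = 0 ∧ j = 3 * m + 4) ∨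
        (i = 3 * m + 1 ∧ j = 3 * m + 2) ∨ (i = 3 * m + 2 ∧ j = 3 * m + 3) ∨
        (i = 3 * m + 1 ∧ j = 3 * m + 3) := by
      rcases h4 with h4 | h4 | h4 <;> omega
    rcases this with ⟨rfl, rfl⟩ | ⟨rfl, rfl⟩ | ⟨rfl, rfl⟩ | ⟨rfl, rfl⟩ | ⟨rfl, rfl⟩ | ⟨rfl, rfl⟩ <;>
      simp

theorem mem_stripEdges {m : ℕ} {e : Sym2 ℕ} :
    e ∈ stripEdges m ↔ ∃ i j, j < 3 * m + 2 ∧ stripRel i j ∧ e = s(i, j) := by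
  induction m with
  | zero =>
    simp only [stripEdges, Finset.range_zero, Finset.sum_empty, add_zero, Multiset.mem_singleton,
      stripRel]
    constructor
    · rintro rfl
      exact ⟨0, 1, by omega, by omega, rfl⟩
    · rintro ⟨i, j, h1, h2, rfl⟩
      simp only [Sym2.eq_iff]
      omega
  | succ m ih =>
    rw [stripEdges_succ, Multiset.mem_add, ih, mem_stripTriangles]
    constructor
    · rintro (⟨i, j, h1, h2, h3⟩ | ⟨i, j, h0, h1, h2, h3⟩)
      · exact ⟨i, j, by omega, h2, h3⟩
      · exact ⟨i, j, by omega, h2, h3⟩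
    · rintro ⟨i, j, h1, h2, h3⟩
      by_cases h : j < 3 * m + 2
      · exact Or.inl ⟨i, j, h, h2, h3⟩
      · exact Or.inr ⟨i, j, by omega, by omega, h2, h3⟩

theorem nodup_stripEdges (m : ℕ) : (stripEdges m).Nodup := by
  induction m with
  | zero => simp [stripEdges]
  | succ m ih =>
    rw [stripEdges_succ, Multiset.nodup_add]
    refine ⟨ih, ?_, ?_⟩
    · simp only [stripTriangleA, stripTriangleB, Multiset.insert_eq_cons, Multiset.cons_add,
        Multiset.singleton_add, Multiset.nodup_cons, Multiset.mem_cons, Multiset.mem_singleton,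
        Multiset.nodup_singleton, Sym2.eq_iff, true_and, and_true]
      omega
    · rw [Multiset.disjoint_left]
      intro e h1 h2
      obtain ⟨i, j, h3, h4, rfl⟩ := mem_stripEdges.mp h1
      obtain ⟨i', j', h5, h6, h7, h8⟩ := mem_stripTriangles.mp h2
      rw [Sym2.eq_iff] at h8
      have := h4.1
      have := h7.1
      omega

theorem card_stripEdges (m : ℕ) : (stripEdges m).card = 6 * m + 1 := by
  induction m with
  | zero => simp [stripEdges]
  | succ m ih =>
    rw [stripEdges_succ, Multiset.card_add, ih, Multiset.card_add]
    simp only [stripTriangleA, stripTriangleB, Multiset.insert_eq_cons, Multiset.card_cons,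
      Multiset.card_singleton]
    omega

/-- The triangulated polygon with edge relation `stripRel`. -/
def stripGraph (n : ℕ) : SimpleGraph (Fin n) := SimpleGraph.fromRel fun i j => stripRel i j

theorem stripGraph_adj {n : ℕ} {i j : Fin n} :
    (stripGraph n).Adj i j ↔ stripRel i j ∨ stripRel j i := by
  rw [stripGraph, SimpleGraph.fromRel_adj]
  refine and_iff_right_of_imp ?_
  rintro (h | h) rfl <;> exact lt_irrefl _ h.1

theorem stripGraph_noncrossingAt (n : ℕ) : (stripGraph n).NoncrossingAt fun v => v := by
  intro w x y z h1 h2 h3 hwy hxz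
  have h1 : (w : ℕ) < x := h1
  have h2 : (x : ℕ) < y := h2
  have h3 : (y : ℕ) < z := h3
  rw [stripGraph_adj] at hwy hxz
  simp only [stripRel] at hwy hxz
  omega

theorem map_edgeMultiset_stripGraph (m : ℕ) :
    (edgeMultiset (stripGraph (3 * m + 2))).map (Sym2.map Fin.val) = stripEdges m := by
  have hinj : Function.Injective (Sym2.map (Fin.val : Fin (3 * m + 2) → ℕ)) :=
    Sym2.map.injective Fin.val_injective
  rw [edgeMultiset, Multiset.Nodup.ext ((Finset.nodup _).map hinj) (nodup_stripEdges m)]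
  intro e
  rw [mem_stripEdges, Multiset.mem_map]
  simp only [Finset.mem_val, Set.Finite.mem_toFinset]
  constructor
  · rintro ⟨e, he, rfl⟩
    induction e using Sym2.ind with
    | _ u v =>
      rcases stripGraph_adj.mp he with h | h
      · exact ⟨u, v, v.2, h, rfl⟩
      · exact ⟨v, u, u.2, h, Sym2.eq_swap⟩
  · rintro ⟨i, j, hj, h, rfl⟩
    exact ⟨s(⟨i, h.1.trans hj⟩, ⟨j, hj⟩), stripGraph_adj.mpr (Or.inl h), rfl⟩

theorem edgeMultiset_stripGraph (m : ℕ) :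
    edgeMultiset (stripGraph (3 * m + 2)) =
      (stripEdges m).map (Sym2.map (Fin.ofNat (3 * m + 2))) := by
  rw [← map_edgeMultiset_stripGraph, Multiset.map_map]
  have : Sym2.map (Fin.ofNat (3 * m + 2)) ∘ Sym2.map Fin.val = id := by
    rw [← Sym2.map_comp]
    have : Fin.ofNat (3 * m + 2) ∘ Fin.val = id := by
      funext x
      exact Fin.ofNat_val_eq_self x
    rw [this, Sym2.map_id]
  rw [this, Multiset.map_id]

theorem card_edgeMultiset {V : Type*} [Finite V] (G : SimpleGraph V) :
    (edgeMultiset G).card = G.edgeSet.ncard :=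
  (Set.ncard_eq_toFinset_card _ _).symm

/-- The strip is maximal outerplanar, since it is outerplanar and has as many edges as an outerplanar
graph can have. -/
theorem isMaximalOuterplanar_stripGraph (m : ℕ) :
    IsMaximalOuterplanar (stripGraph (3 * m + 2)) := by
  refine ⟨(stripGraph_noncrossingAt _).isOuterplanar Fin.val_injective, fun u v huv hadj hout => ?_⟩
  have h1 := hout.ncard_edgeSet_le (by omega)
  have h2 : (stripGraph (3 * m + 2)).edgeSet.ncard = 6 * m + 1 := by
    rw [← card_edgeMultiset, ← card_stripEdges, ← map_edgeMultiset_stripGraph, Multiset.card_map]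
  have h3 : (stripGraph (3 * m + 2)).edgeSet ⊂
      (stripGraph (3 * m + 2) ⊔ SimpleGraph.edge u v).edgeSet := by
    rw [SimpleGraph.edgeSet_ssubset_edgeSet]
    refine lt_of_le_of_ne le_sup_left fun h => hadj ?_
    rw [h]
    exact Or.inr (by simp [SimpleGraph.edge_adj, huv])
  have := Set.ncard_lt_ncard h3 (Set.toFinite _)
  omega

theorem isTriangleEdges_map {V W : Type*} {f : V → W} {t : Multiset (Sym2 V)}
    (h : ∃ a b c : V, f a ≠ f b ∧ f b ≠ f c ∧ f a ≠ f c ∧ t = {s(a, b), s(b, c), s(a, c)}) :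
    IsTriangleEdges (t.map (Sym2.map f)) := by
  obtain ⟨a, b, c, h1, h2, h3, rfl⟩ := h
  exact ⟨f a, f b, f c, h1, h2, h3, by simp⟩

/-- Two additional edges suffice for the strip: the outer triangles cover each edge once, apart
from the edge `01`, which is covered by the triangle `013`. -/
theorem triangleEpsilon_stripGraph_le {m : ℕ} (hm : 1 ≤ m) :
    triangleEpsilon (stripGraph (3 * m + 2)) ≤ 2 := by
  let c : ℕ → Fin (3 * m + 2) := Fin.ofNat (3 * m + 2)
  have hc : ∀ {i j}, i < 3 * m + 2 → j < 3 * m + 2 → i ≠ j → c i ≠ c j := by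
    intro i j hi hj hij h
    have := congrArg Fin.val h
    simp only [c, Fin.val_ofNat, Nat.mod_eq_of_lt hi, Nat.mod_eq_of_lt hj] at this
    exact hij this
  have hcv : ∀ {i}, i < 3 * m + 2 → (c i : ℕ) = i := by
    intro i hi
    simp only [c, Fin.val_ofNat, Nat.mod_eq_of_lt hi]
  refine sInf_le ⟨{s(c 0, c 3), s(c 1, c 3)}, ?_, ?_, by simp⟩
  · intro e he
    simp only [Multiset.insert_eq_cons, Multiset.mem_cons, Multiset.mem_singleton] at he
    have hadj : ∀ i < 2, (stripGraph (3 * m + 2)).Adj (c i) (c 3) := by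
      intro i hi
      rw [stripGraph_adj, hcv (i := i) (by omega), hcv (i := 3) (by omega)]
      left
      simp only [stripRel]
      omega
    rcases he with rfl | rfl
    exacts [hadj 0 (by omega), hadj 1 (by omega)]
  · refine ⟨Multiset.map (Multiset.map (Sym2.map c)) ({s(0, 1), s(1, 3), s(0, 3)} ::ₘ
      ((Multiset.range m).map stripTriangleA + (Multiset.range m).map stripTriangleB)), ?_, ?_⟩
    · intro t' ht'
      obtain ⟨t, ht, rfl⟩ := Multiset.mem_map.mp ht'
      refine isTriangleEdges_map ?_
      rw [Multiset.mem_cons, Multiset.mem_add, Multiset.mem_map, Multiset.mem_map] at ht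
      simp only [Multiset.mem_range] at ht
      rcases ht with rfl | ⟨s, hs, rfl⟩ | ⟨s, hs, rfl⟩
      · exact ⟨0, 1, 3, hc (by omega) (by omega) (by omega), hc (by omega) (by omega) (by omega),
          hc (by omega) (by omega) (by omega), rfl⟩
      · exact ⟨_, _, _, hc (by omega) (by omega) (by omega), hc (by omega) (by omega) (by omega),
          hc (by omega) (by omega) (by omega), rfl⟩
      · exact ⟨_, _, _, hc (by omega) (by omega) (by omega), hc (by omega) (by omega) (by omega),
          hc (by omega) (by omega) (by omega), rfl⟩
    · rw [edgeMultiset_stripGraph]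
      change (Multiset.map (Multiset.mapAddMonoidHom (Sym2.map c)) _).sum = _
      rw [← map_multiset_sum, Multiset.sum_cons, Multiset.sum_add]
      have h1 : ((Multiset.range m).map stripTriangleA).sum =
        ∑ s ∈ Finset.range m, stripTriangleA s := rfl
      have h2 : ((Multiset.range m).map stripTriangleB).sum =
        ∑ s ∈ Finset.range m, stripTriangleB s := rfl
      have h3 : ({s(c 0, c 3), s(c 1, c 3)} : Multiset (Sym2 (Fin (3 * m + 2)))) =
        Multiset.map (Sym2.map c) {s(0, 3), s(1, 3)} := by simp
      rw [h1, h2, h3, ← Multiset.map_add]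
      change Multiset.map (Sym2.map c) _ = _
      congr 1
      rw [stripEdges, add_right_comm]
      congr 1
      rw [Multiset.singleton_add, Multiset.pair_comm]
      rfl

/-- The number of edges of a triangle decomposable multigraph is divisible by three. -/
theorem IsTriangleDecomposable.three_dvd_card {V : Type*} {E : Multiset (Sym2 V)}
    (h : IsTriangleDecomposable E) : 3 ∣ E.card := by
  obtain ⟨T, hT, rfl⟩ := h
  have hsum : T.sum.card = (T.map Multiset.card).sum := map_multiset_sum Multiset.cardHom T
  rw [hsum]
  refine Multiset.dvd_sum fun k hk => ?_
  obtain ⟨t, ht, rfl⟩ := Multiset.mem_map.mp hk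
  obtain ⟨a, b, c, -, -, -, rfl⟩ := hT t ht
  simp

/-- For a maximal outerplanar graph of order `n`, the number `k` of added edges satisfies
`2 n - 3 + k ≡ 0` modulo three. -/
theorem IsMaximalOuterplanar.three_dvd {n : ℕ} (hn : 2 ≤ n) {G : SimpleGraph (Fin n)}
    (h : IsMaximalOuterplanar G) {M : Multiset (Sym2 (Fin n))}
    (hM : IsTriangleDecomposable (edgeMultiset G + M)) : 3 ∣ 2 * n + M.card := by
  have h1 := hM.three_dvd_card
  have h2 := h.ncard_edgeSet hn
  rw [Multiset.card_add, card_edgeMultiset] at h1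
  omega

theorem theorem6 (n : ℕ) (hn : 3 ≤ n) : triangleEpsilonOP n = 2 ↔ n ≡ 2 [MOD 3] := by
  rw [Nat.ModEq]
  constructor
  · intro h
    -- both minima are attained, since they are finite
    have hne : (triangleEpsilon '' maximalOuterplanarGraphs n).Nonempty := by
      by_contra hcon
      rw [Set.not_nonempty_iff_eq_empty] at hcon
      rw [triangleEpsilonOP, hcon, sInf_empty] at h
      exact absurd h (by decide)
    obtain ⟨G, hG, hGe⟩ := csInf_mem hne
    have hG2 : triangleEpsilon G = 2 := hGe.trans h
    have hne' : {k : ℕ∞ | ∃ M : Multiset (Sym2 (Fin n)), (∀ e ∈ M, e ∈ G.edgeSet) ∧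
        IsTriangleDecomposable (edgeMultiset G + M) ∧ k = (Multiset.card M : ℕ∞)}.Nonempty := by
      by_contra hcon
      rw [Set.not_nonempty_iff_eq_empty] at hcon
      rw [triangleEpsilon, hcon, sInf_empty] at hG2
      exact absurd hG2 (by decide)
    obtain ⟨M, -, hM, hk⟩ := csInf_mem hne'
    have hcard : M.card = 2 := by
      have : (M.card : ℕ∞) = 2 := hk.symm.trans hG2
      exact_mod_cast this
    have := IsMaximalOuterplanar.three_dvd (by omega) hG hM
    omega
  · intro h
    apply le_antisymm
    · obtain ⟨m, rfl⟩ : ∃ m, n = 3 * m + 2 := ⟨n / 3, by omega⟩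
      have hm : 1 ≤ m := by omega
      have hmem : stripGraph (3 * m + 2) ∈ maximalOuterplanarGraphs (3 * m + 2) :=
        isMaximalOuterplanar_stripGraph m
      exact (sInf_le (Set.mem_image_of_mem triangleEpsilon hmem)).trans (triangleEpsilon_stripGraph_le hm)
    · refine le_sInf ?_
      rintro _ ⟨G, hG, rfl⟩
      refine le_sInf ?_
      rintro _ ⟨M, -, hM, rfl⟩
      have := IsMaximalOuterplanar.three_dvd (by omega) hG hM
      have h2 : 2 ≤ M.card := by omega
      exact_mod_cast h2
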